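/- All graphs are finite and simple. For a set $I$ of vertices of a graph $G$ let $N(I)$ be the set of common neighbours of the vertices of $I$, and let $k_b(G)$ be the number of copies of $K_b$ in $G$. For $a\ge 1$ and $b\ge 2$ put $$\delta^{(a)}(G)=\min_{I}|N(I)|,\qquad \hat\delta^{(a,b)}(G)=\min_{I}\frac{k_b(G[N(I)])}{\binom{|N(I)|}{b}},$$ where both minima are over all independent sets $I$ of size $a$ in $G$ (a minimum over the empty family is $+\infty$, and $0/0:=0$). For a graph $H$, let $\delta_{\mathrm{hom}}^{(a)}(H)$ be the infimum of all $\alpha\ge 0$ for which there is an $H$-free graph $F$ such that, for every $n$, every $n$-vertex $H$-free graph $G$ with $\delta^{(a)}(G)\ge\alpha n$ admits a homomorphism to $F$. Let $\delta_{\mathrm{hom}}^{(a,b)}(H)$ be the infimum of all $\alpha\ge 0$ such that for every $c>0$ there is an $H$-free graph $F$ such that, for every $n$, every $n$-vertex $H$-free graph $G$ with $\delta^{(a)}(G)\ge cn$ and $\hat\delta^{(a,b)}(G)\ge\alpha$ admits a homomorphism to $F$. Finally, let $\pi_s(K_t)=\lim_{n\to\infty}\mathrm{ex}(n,K_s,K_t)/\binom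 ns$, where $\mathrm{ex}(n,K_s,K_t)$ is the maximum number of copies of $K_s$ in an $n$-vertex $K_t$-free graph. Let $r\ge 3$ and $a\ge 2$ be integers. Then $$\delta_{\mathrm{hom}}^{(a)}(K_r)=\frac{r-3}{r-2}.$$ Moreover, for every integer $b$ with $2\le b\le r-2$, the limit defining $\pi_b(K_{r-2})$ exists and $$\delta_{\mathrm{hom}}^{(a,b)}(K_r)=\pi_b(K_{r-2})=\prod_{i=1}^{b-1}\frac{r-3-i}{r-3}.$$ -/

import Mathlib

open Filter Topology

noncomputable section

namespace HomThr

/-- The common neighbourhood `N(I)` of a set `I` of vertices. -/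
def commonNbhd {V : Type*} (G : SimpleGraph V) (I : Finset V) : Set V :=
  {v | ∀ u ∈ I, G.Adj u v}

/-- `k_b(G)`: the number of copies of `K_b` in `G`, i.e. of `b`-element cliques. -/
def numCliques {V : Type*} (b : ℕ) (G : SimpleGraph V) : ℕ :=
  (G.cliqueSet b).ncard

/-- `δ^{(a)}(G)`: the minimum co-degree `|N(I)|` over all independent sets `I` of size `a`
(the minimum over the empty family is `+∞`). -/
def minCodegree {V : Type*} (a : ℕ) (G : SimpleGraph V) : EReal :=
  ⨅ (I : Finset V) (_ : G.IsNIndepSet a I), (((commonNbhd G I).ncard : ℝ) : EReal)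

/-- The relative `K_b`-density `k_b(G[N(I)]) / binom(|N(I)|, b)`. -/
def relCliqueDensity {V : Type*} (b : ℕ) (G : SimpleGraph V) (I : Finset V) : ℝ :=
  (numCliques b (G.induce (commonNbhd G I)) : ℝ) / ((commonNbhd G I).ncard.choose b : ℝ)

/-- `δ̂^{(a,b)}(G)`: the minimum relative `K_b`-density in the common neighbourhood of `I`
over all independent sets `I` of size `a` (the minimum over the empty family is `+∞`). -/
def minRelCliqueDensity {V : Type*} (a b : ℕ) (G : SimpleGraph V) : EReal :=
  ⨅ (I : Finset V) (_ : G.IsNIndepSet a I), ((relCliqueDensity b G I : ℝ) : EReal)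

/-- `α` is admissible for `δ_hom^{(a)}(H)`: some finite `H`-free graph `F` is a homomorphic target
of all finite `H`-free graphs `G` with `δ^{(a)}(G) ≥ α |G|`. -/
def Admissible {W : Type*} (a : ℕ) (H : SimpleGraph W) (α : ℝ) : Prop :=
  0 ≤ α ∧ ∃ (m : ℕ) (F : SimpleGraph (Fin m)), H.Free F ∧
    ∀ (n : ℕ) (G : SimpleGraph (Fin n)), H.Free G →
      ((α * n : ℝ) : EReal) ≤ minCodegree a G → Nonempty (G →g F)

/-- The higher moment homomorphism threshold `δ_hom^{(a)}(H)`. -/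
def homThreshold {W : Type*} (a : ℕ) (H : SimpleGraph W) : EReal :=
  ⨅ (α : ℝ) (_ : Admissible a H α), (α : EReal)

/-- `α` is admissible for `δ_hom^{(a,b)}(H)`. The condition `δ^{(a)}(G) = Ω(n)` is
`δ^{(a)}(G) ≥ c n` for a constant `c > 0`; the target `F` may depend on `c`, not on `G`. -/
def DensityAdmissible {W : Type*} (a b : ℕ) (H : SimpleGraph W) (α : ℝ) : Prop :=
  0 ≤ α ∧ ∀ c : ℝ, 0 < c → ∃ (m : ℕ) (F : SimpleGraph (Fin m)), H.Free F ∧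
    ∀ (n : ℕ) (G : SimpleGraph (Fin n)), H.Free G →
      ((c * n : ℝ) : EReal) ≤ minCodegree a G →
      (α : EReal) ≤ minRelCliqueDensity a b G → Nonempty (G →g F)

/-- The homomorphism threshold `δ_hom^{(a,b)}(H)`. -/
def homDensityThreshold {W : Type*} (a b : ℕ) (H : SimpleGraph W) : EReal :=
  ⨅ (α : ℝ) (_ : DensityAdmissible a b H α), (α : EReal)

/-- `ex(n, K_s, K_t)`: the maximum number of copies of `K_s` in an `n`-vertex `K_t`-free graph. -/
def exClique (n s t : ℕ) : ℕ :=
  sSup {k | ∃ G : SimpleGraph (Fin n),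
    (SimpleGraph.completeGraph (Fin t)).Free G ∧ k = numCliques s G}

/-- The sequence `ex(n, K_s, K_t) / binom(n, s)`. -/
def exCliqueRatio (s t n : ℕ) : ℝ :=
  (exClique n s t : ℝ) / (n.choose s : ℝ)

/-- The generalized Turán density `π_s(K_t) = lim ex(n, K_s, K_t) / binom(n, s)`. -/
def turanCliqueDensity (s t : ℕ) : ℝ :=
  limUnder atTop (exCliqueRatio s t)

end HomThr

end

/-! Write `r = k + 3` and `t = k + 1`, so that `K_r = K_{t+2}`.

Upper bounds. Suppose every independent `a`-set has at least `c n^t` ordered `t`-cliques in its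
common neighbourhood (`RichCommonNbhds`). Attach to each vertex `u` the set of ordered `t`-cliques
inside its neighbourhood (`cliqueLink`). Adjacent vertices have disjoint links, since a common
clique would complete a `K_{t+2}`. Non-adjacent vertices in a common independent `a`-set have links
meeting in at least `c n^t` tuples. The remaining non-adjacent pairs are sparse: by Ramsey each
vertex lies in boundedly many of them. This dichotomy bounds the VC dimension of the family of links
(`card_lt_of_shatters_cliqueLink`), so a packing lemma bounds the number of well-separated links.
Group the vertices by a nearby link of a maximal separated set. One edge between two groups then
forces all pairs between them to be adjacent or exceptional. Breaking the small groups into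
singletons leaves a quotient of bounded size, and it is still `K_{t+2}`-free because its cliques can
be lifted greedily (`quotientGraph_cliqueFree`). This is `exists_bounded_target`; a disjoint union
of all small clique-free graphs turns the bounded targets into a single one.

Richness comes from the threshold hypotheses. For co-degree above `k/(k+1)`, all degrees are large
and cliques are built greedily. For `K_b`-density above the Turán value, the Moon–Moser inequality
gives supersaturation of `K_{k+1}` inside the common neighbourhoods.

Lower bounds. Take a balanced complete `(k+1)`-partite graph and place in one part a triangle-free
graph of large chromatic number. It is `K_{k+3}`-free and has no homomorphism to a given finite
graph, while an independent set stays inside one part and sees all the others. The same multipartite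
count, applied to Turán graphs, shows that Zykov's bound is asymptotically attained. -/

namespace HomThr

/-! ### Ramsey's theorem, ordered cliques, the Moon–Moser inequality and supersaturation -/

section CliqueTuples

open scoped Classical
open Finset

/-- A finite form of Ramsey's theorem for cliques and independent sets. -/
theorem exists_ramsey (s t : ℕ) : ∃ R : ℕ, ∀ {V : Type} (G : SimpleGraph V) (S : Finset V),
    R ≤ #S → (∃ T ⊆ S, G.IsNClique s T) ∨ ∃ T ⊆ S, G.IsNIndepSet t T := by
  induction s generalizing t with
  | zero => exact ⟨0, fun G S _ => Or.inl ⟨∅, by simp, by simp⟩⟩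
  | succ s ihs =>
    induction t with
    | zero =>
      refine ⟨0, fun G S _ => Or.inr ⟨∅, by simp, ?_⟩⟩
      rw [← SimpleGraph.isNClique_compl]
      simp
    | succ t iht =>
      obtain ⟨R₁, h₁⟩ := ihs (t + 1)
      obtain ⟨R₂, h₂⟩ := iht
      -- Remove one vertex `v`: either `R₁` of the others are neighbours of `v`, or `R₂` are
      -- non-neighbours.
      refine ⟨R₁ + R₂ + 1, fun {V} G S hS => ?_⟩
      obtain ⟨v, hv⟩ : S.Nonempty := by
        rw [← Finset.card_pos]; omega
      have hc := Finset.card_filter_add_card_filter_not (s := S.erase v) (fun w => G.Adj v w)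
      rw [Finset.card_erase_of_mem hv] at hc
      by_cases h : R₁ ≤ #{w ∈ S.erase v | G.Adj v w}
      · rcases h₁ G _ h with ⟨T, hT, hc⟩ | ⟨T, hT, hi⟩
        · refine Or.inl ⟨insert v T, ?_, hc.insert fun b hb => (Finset.mem_filter.1 (hT hb)).2⟩
          refine Finset.insert_subset hv fun x hx => ?_
          exact Finset.mem_of_mem_erase (Finset.mem_filter.1 (hT hx)).1
        · exact Or.inr ⟨T, fun x hx =>
            Finset.mem_of_mem_erase (Finset.mem_filter.1 (hT hx)).1, hi⟩
      · have h' : R₂ ≤ #{w ∈ S.erase v | ¬ G.Adj v w} := by omega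
        rcases h₂ G _ h' with ⟨T, hT, hc⟩ | ⟨T, hT, hi⟩
        · exact Or.inl ⟨T, fun x hx =>
            Finset.mem_of_mem_erase (Finset.mem_filter.1 (hT hx)).1, hc⟩
        · refine Or.inr ⟨insert v T, ?_, ?_⟩
          · refine Finset.insert_subset hv fun x hx => ?_
            exact Finset.mem_of_mem_erase (Finset.mem_filter.1 (hT hx)).1
          · rw [← SimpleGraph.isNClique_compl] at hi ⊢
            refine hi.insert fun b hb => ?_
            have := Finset.mem_filter.1 (hT hb)
            exact ⟨(Finset.ne_of_mem_erase this.1).symm, this.2⟩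

/-- The ordered `k`-cliques of `G`. -/
noncomputable def cliqueTuples {V : Type} [Fintype V] (G : SimpleGraph V) (k : ℕ) :
    Finset (Fin k → V) :=
  {q | ∀ i j, i ≠ j → G.Adj (q i) (q j)}

variable {V : Type} [Fintype V] {G : SimpleGraph V} {k : ℕ}

theorem mem_cliqueTuples {q : Fin k → V} :
    q ∈ cliqueTuples G k ↔ ∀ i j, i ≠ j → G.Adj (q i) (q j) := by
  simp [cliqueTuples]

theorem cliqueTuples_injective {q : Fin k → V} (hq : q ∈ cliqueTuples G k) :
    Function.Injective q := by
  intro i j hij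
  by_contra h
  exact (mem_cliqueTuples.1 hq i j h).ne hij

theorem isNClique_image {q : Fin k → V} (hq : q ∈ cliqueTuples G k) :
    G.IsNClique k (univ.image q) := by
  refine ⟨?_, by simp [Finset.card_image_of_injective _ (cliqueTuples_injective hq)]⟩
  intro x hx y hy hxy
  simp only [coe_image, coe_univ, Set.image_univ, Set.mem_range] at hx hy
  obtain ⟨i, rfl⟩ := hx
  obtain ⟨j, rfl⟩ := hy
  exact mem_cliqueTuples.1 hq i j fun h => hxy (h ▸ rfl)

theorem exists_cliqueTuple_of_isNClique {s : Finset V} (hs : G.IsNClique k s) :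
    ∃ q ∈ cliqueTuples G k, ∀ i, q i ∈ s := by
  have e := s.equivFinOfCardEq hs.card_eq
  refine ⟨fun i => (e.symm i).1, mem_cliqueTuples.2 fun i j hij => ?_, fun i => (e.symm i).2⟩
  exact hs.1 (e.symm i).2 (e.symm j).2
    fun h => hij (e.symm.injective (Subtype.ext h))

theorem cliqueFree_iff_cliqueTuples : G.CliqueFree k ↔ cliqueTuples G k = ∅ := by
  constructor
  · intro h
    refine Finset.eq_empty_of_forall_notMem fun q hq => ?_
    exact h _ (isNClique_image hq)
  · intro h s hs
    obtain ⟨q, hq, -⟩ := exists_cliqueTuple_of_isNClique hs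
    simp [h] at hq

/-- The fibre of `q ↦ univ.image q` over a clique `s` consists of the bijections `Fin b ≃ s`. -/
theorem card_cliqueTuples (G : SimpleGraph V) (b : ℕ) :
    #(cliqueTuples G b) = b.factorial * numCliques b G := by
  have hn : numCliques b G = #(G.cliqueFinset b) := by
    rw [numCliques, ← SimpleGraph.coe_cliqueFinset, Set.ncard_coe_finset]
  have hmaps : ∀ q ∈ cliqueTuples G b, univ.image q ∈ G.cliqueFinset b := fun q hq =>
    SimpleGraph.mem_cliqueFinset_iff.2 (isNClique_image hq)
  rw [hn, mul_comm, Finset.card_eq_sum_card_fiberwise (f := fun q => univ.image q) hmaps]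
  refine Finset.sum_const_nat fun s hs => ?_
  rw [SimpleGraph.mem_cliqueFinset_iff] at hs
  have e := (s.equivFinOfCardEq hs.card_eq).symm
  have hcard : Fintype.card (Fin b ≃ s) = b.factorial := by
    rw [Fintype.card_equiv e, Fintype.card_fin]
  rw [← hcard, ← Finset.card_univ]
  symm
  refine Finset.card_bij (fun φ _ => fun i => (φ i).1) ?_ ?_ ?_
  · intro φ _
    rw [Finset.mem_filter]
    refine ⟨mem_cliqueTuples.2 fun i j hij => hs.1 (φ i).2 (φ j).2
      fun h => hij (φ.injective (Subtype.ext h)), ?_⟩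
    ext v
    simp only [mem_image, mem_univ, true_and]
    constructor
    · rintro ⟨i, rfl⟩
      exact (φ i).2
    · intro hv
      exact ⟨φ.symm ⟨v, hv⟩, by simp⟩
  · intro φ _ ψ _ h
    ext i
    exact congrFun h i
  · intro q hq
    obtain ⟨hq, him⟩ := Finset.mem_filter.1 hq
    have hmem : ∀ i, q i ∈ s := fun i => him ▸ Finset.mem_image_of_mem q (mem_univ i)
    refine ⟨Equiv.ofBijective (fun i => (⟨q i, hmem i⟩ : s)) ⟨?_, ?_⟩, mem_univ _, rfl⟩
    · intro i j hij
      exact cliqueTuples_injective hq (congrArg Subtype.val hij)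
    · rintro ⟨v, hv⟩
      rw [← him] at hv
      obtain ⟨i, -, rfl⟩ := Finset.mem_image.1 hv
      exact ⟨i, rfl⟩

/-- The vertices adjacent to all entries of a tuple. -/
noncomputable def tupleNbhd (G : SimpleGraph V) (q : Fin k → V) : Finset V :=
  {w | ∀ i, G.Adj w (q i)}

theorem mem_tupleNbhd {q : Fin k → V} {w : V} : w ∈ tupleNbhd G q ↔ ∀ i, G.Adj w (q i) := by
  simp [tupleNbhd]

theorem insertNth_mem_cliqueTuples {i : Fin (k + 1)} {q : Fin k → V} {x : V} :
    (i.insertNth x q : Fin (k + 1) → V) ∈ cliqueTuples G (k + 1) ↔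
      q ∈ cliqueTuples G k ∧ x ∈ tupleNbhd G q := by
  rw [mem_cliqueTuples, mem_cliqueTuples, mem_tupleNbhd]
  constructor
  · intro h
    refine ⟨fun j l hjl => ?_, fun j => ?_⟩
    · simpa using h (i.succAbove j) (i.succAbove l) (by simpa using hjl)
    · simpa using h i (i.succAbove j) (Fin.succAbove_ne i j).symm
  · rintro ⟨h₁, h₂⟩ j l hjl
    induction j using Fin.succAboveCases i with
    | x =>
      induction l using Fin.succAboveCases i with
      | x => exact absurd rfl hjl
      | p l => simpa using h₂ l
    | p j =>
      induction l using Fin.succAboveCases i with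
      | x => simpa using (h₂ j).symm
      | p l => simpa using h₁ j l fun h => hjl (h ▸ rfl)

/-- Any coordinate `i` may be split off; the Moon–Moser double count uses every one of them. -/
theorem sum_cliqueTuples_succ (i : Fin (k + 1)) (f : (Fin (k + 1) → V) → ℕ) :
    ∑ A ∈ cliqueTuples G (k + 1), f A =
      ∑ q ∈ cliqueTuples G k, ∑ x ∈ tupleNbhd G q, f (i.insertNth x q) := by
  rw [Finset.sum_sigma']
  refine Finset.sum_bij' (fun A _ => ⟨i.removeNth A, A i⟩) (fun p _ => i.insertNth p.2 p.1)
    ?_ ?_ ?_ ?_ ?_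
  · intro A hA
    rw [Finset.mem_sigma, ← insertNth_mem_cliqueTuples (i := i)]
    simpa using hA
  · rintro ⟨q, x⟩ h
    rw [Finset.mem_sigma] at h
    exact insertNth_mem_cliqueTuples.2 h
  · intro A _
    simp
  · rintro ⟨q, x⟩ _
    simp
  · intro A _
    simp

theorem card_cliqueTuples_succ (G : SimpleGraph V) (k : ℕ) :
    #(cliqueTuples G (k + 1)) = ∑ q ∈ cliqueTuples G k, #(tupleNbhd G q) := by
  rw [Finset.card_eq_sum_ones, sum_cliqueTuples_succ 0]
  simp

/-- A vertex adjacent to all of `A` is counted `k + 1` times. Any other vertex is counted at most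
once, since the removed entry must be its only non-neighbour in `A`. -/
theorem sum_card_tupleNbhd_removeNth_le (A : Fin (k + 1) → V) :
    ∑ i : Fin (k + 1), #(tupleNbhd G (i.removeNth A)) ≤
      Fintype.card V + k * #(tupleNbhd G A) := by
  have h₁ : ∀ i : Fin (k + 1), #(tupleNbhd G (i.removeNth A)) =
      ∑ w : V, if w ∈ tupleNbhd G (i.removeNth A) then 1 else 0 := fun i => by simp
  simp_rw [h₁]
  rw [Finset.sum_comm]
  have h₂ : Fintype.card V + k * #(tupleNbhd G A) =
      ∑ w : V, (1 + k * if w ∈ tupleNbhd G A then 1 else 0) := by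
    rw [Finset.sum_add_distrib, ← Finset.mul_sum]
    simp
  rw [h₂]
  refine Finset.sum_le_sum fun w _ => ?_
  rw [← Finset.card_filter]
  by_cases hw : w ∈ tupleNbhd G A
  · rw [if_pos hw]
    refine (Finset.card_filter_le _ _).trans ?_
    simp [add_comm]
  · rw [if_neg hw, mul_zero, add_zero, Finset.card_le_one]
    rw [mem_tupleNbhd] at hw
    push Not at hw
    obtain ⟨j, hj⟩ := hw
    have key : ∀ i : Fin (k + 1), w ∈ tupleNbhd G (i.removeNth A) → i = j := by
      intro i hi
      by_contra hij
      obtain ⟨l, rfl⟩ := Fin.exists_succAbove_eq (Ne.symm hij)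
      exact hj (mem_tupleNbhd.1 hi l)
    intro i hi l hl
    rw [key i (Finset.mem_filter.1 hi).2, key l (Finset.mem_filter.1 hl).2]

/-- The Moon–Moser inequality for ordered cliques. -/
theorem moon_moser (G : SimpleGraph V) (k : ℕ) :
    (k + 1) * #(cliqueTuples G (k + 1)) ^ 2 ≤ #(cliqueTuples G k) *
      (Fintype.card V * #(cliqueTuples G (k + 1)) + k * #(cliqueTuples G (k + 2))) := by
  have h₁ : ∀ i : Fin (k + 1), ∑ A ∈ cliqueTuples G (k + 1), #(tupleNbhd G (i.removeNth A)) =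
      ∑ q ∈ cliqueTuples G k, #(tupleNbhd G q) ^ 2 := by
    intro i
    rw [sum_cliqueTuples_succ i]
    refine Finset.sum_congr rfl fun q _ => ?_
    simp [sq]
  have h₂ : (k + 1) * ∑ q ∈ cliqueTuples G k, #(tupleNbhd G q) ^ 2 ≤
      Fintype.card V * #(cliqueTuples G (k + 1)) + k * #(cliqueTuples G (k + 2)) := by
    calc (k + 1) * ∑ q ∈ cliqueTuples G k, #(tupleNbhd G q) ^ 2
        = ∑ i : Fin (k + 1), ∑ A ∈ cliqueTuples G (k + 1), #(tupleNbhd G (i.removeNth A)) := by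
          simp_rw [h₁]
          simp
      _ = ∑ A ∈ cliqueTuples G (k + 1), ∑ i : Fin (k + 1), #(tupleNbhd G (i.removeNth A)) :=
          Finset.sum_comm
      _ ≤ ∑ A ∈ cliqueTuples G (k + 1), (Fintype.card V + k * #(tupleNbhd G A)) :=
          Finset.sum_le_sum fun A _ => sum_card_tupleNbhd_removeNth_le A
      _ = _ := by
          rw [Finset.sum_add_distrib, ← Finset.mul_sum, ← card_cliqueTuples_succ]
          simp [mul_comm]
  calc (k + 1) * #(cliqueTuples G (k + 1)) ^ 2
      = (k + 1) * (∑ q ∈ cliqueTuples G k, #(tupleNbhd G q)) ^ 2 := by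
        rw [← card_cliqueTuples_succ]
    _ ≤ (k + 1) * (#(cliqueTuples G k) * ∑ q ∈ cliqueTuples G k, #(tupleNbhd G q) ^ 2) :=
        -- Cauchy–Schwarz over the ordered `k`-cliques.
        Nat.mul_le_mul_left _ sq_sum_le_card_mul_sum_sq
    _ = #(cliqueTuples G k) * ((k + 1) * ∑ q ∈ cliqueTuples G k, #(tupleNbhd G q) ^ 2) := by
        ring
    _ ≤ _ := Nat.mul_le_mul_left _ h₂

/-- The homomorphism density of `K_k` in `G`. -/
noncomputable def cliqueDensity (G : SimpleGraph V) (k : ℕ) : ℝ :=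
  #(cliqueTuples G k) / (Fintype.card V : ℝ) ^ k

theorem cliqueDensity_nonneg (G : SimpleGraph V) (k : ℕ) : 0 ≤ cliqueDensity G k := by
  unfold cliqueDensity; positivity

theorem cliqueDensity_one [Nonempty V] (G : SimpleGraph V) : cliqueDensity G 1 = 1 := by
  have h : cliqueTuples G 1 = univ := by
    ext q
    simp only [mem_cliqueTuples, mem_univ, iff_true]
    intro i j hij
    exact absurd (Subsingleton.elim i j) hij
  rw [cliqueDensity, h]
  simp

theorem cliqueDensity_succ_le [Nonempty V] (G : SimpleGraph V) (k : ℕ) :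
    cliqueDensity G (k + 1) ≤ cliqueDensity G k := by
  have hm : (0 : ℝ) < Fintype.card V := by exact_mod_cast Fintype.card_pos
  have h : #(cliqueTuples G (k + 1)) ≤ #(cliqueTuples G k) * Fintype.card V := by
    rw [card_cliqueTuples_succ]
    exact Finset.sum_le_card_nsmul _ _ _ fun q _ => Finset.card_le_univ _
  unfold cliqueDensity
  rw [div_le_div_iff₀ (by positivity) (by positivity), pow_succ]
  have h' : (#(cliqueTuples G (k + 1)) : ℝ) ≤ #(cliqueTuples G k) * Fintype.card V := by
    exact_mod_cast h
  calc (#(cliqueTuples G (k + 1)) : ℝ) * (Fintype.card V : ℝ) ^ k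
      ≤ (#(cliqueTuples G k) * Fintype.card V) * (Fintype.card V : ℝ) ^ k := by gcongr
    _ = _ := by ring

theorem cliqueDensity_antitone [Nonempty V] (G : SimpleGraph V) : Antitone (cliqueDensity G) :=
  antitone_nat_of_succ_le (cliqueDensity_succ_le G)

theorem moon_moser_density [Nonempty V] (G : SimpleGraph V) (k : ℕ) :
    (k + 1) * cliqueDensity G (k + 1) ^ 2 ≤
      cliqueDensity G k * (cliqueDensity G (k + 1) + k * cliqueDensity G (k + 2)) := by
  have hm : (0 : ℝ) < Fintype.card V := by exact_mod_cast Fintype.card_pos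
  have h : ((k : ℝ) + 1) * (#(cliqueTuples G (k + 1)) : ℝ) ^ 2 ≤ #(cliqueTuples G k) *
      (Fintype.card V * #(cliqueTuples G (k + 1)) + k * #(cliqueTuples G (k + 2))) := by
    exact_mod_cast moon_moser G k
  unfold cliqueDensity
  have e₁ : ((k : ℝ) + 1) * (#(cliqueTuples G (k + 1)) / (Fintype.card V : ℝ) ^ (k + 1)) ^ 2 =
      (((k : ℝ) + 1) * (#(cliqueTuples G (k + 1)) : ℝ) ^ 2) /
        (Fintype.card V : ℝ) ^ (2 * k + 2) := by
    field_simp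
    ring
  have e₂ : (#(cliqueTuples G k) / (Fintype.card V : ℝ) ^ k) *
      (#(cliqueTuples G (k + 1)) / (Fintype.card V : ℝ) ^ (k + 1) +
        k * (#(cliqueTuples G (k + 2)) / (Fintype.card V : ℝ) ^ (k + 2))) =
      (#(cliqueTuples G k) *
        (Fintype.card V * #(cliqueTuples G (k + 1)) + k * #(cliqueTuples G (k + 2)))) /
        (Fintype.card V : ℝ) ^ (2 * k + 2) := by
    field_simp
    ring
  rw [e₁, e₂]
  gcongr

/-- Ratios of consecutive clique densities above the Turán value stay above it. -/
theorem cliqueDensity_ratio_step [Nonempty V] (G : SimpleGraph V) {k : ℕ} (hk : 1 ≤ k) {l : ℝ}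
    (hpos : 0 < cliqueDensity G k) (h : (1 - k * l) * cliqueDensity G k ≤ cliqueDensity G (k + 1)) :
    (1 - (k + 1) * l) * cliqueDensity G (k + 1) ≤ cliqueDensity G (k + 2) := by
  have hmm := moon_moser_density G k
  have hk' : (0 : ℝ) < k := by exact_mod_cast hk
  have h₁ := mul_le_mul_of_nonneg_left h
    (mul_nonneg (by positivity : (0 : ℝ) ≤ k + 1) (cliqueDensity_nonneg G (k + 1)))
  -- Uses `(k + 1)(1 - k l) - 1 = k (1 - (k + 1) l)`.
  have h₂ : (k * cliqueDensity G k) * ((1 - (k + 1) * l) * cliqueDensity G (k + 1)) ≤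
      (k * cliqueDensity G k) * cliqueDensity G (k + 2) := by
    nlinarith
  exact le_of_mul_le_mul_left h₂ (by positivity)

/-- Supersaturation: a `K_{b+1}`-density above the Turán value forces many `K_{k+1}`. -/
theorem supersaturation {b k : ℕ} (hk : 1 ≤ k) (hb : b ≤ k) {α : ℝ}
    (hα : ∏ i ∈ range b, (1 - ((i : ℝ) + 1) / k) < α) :
    ∃ c : ℝ, 0 < c ∧ ∀ {V : Type} [Fintype V] [Nonempty V] (G : SimpleGraph V),
      α ≤ cliqueDensity G (b + 1) → c ≤ cliqueDensity G (k + 1) := by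
  have hk' : (0 : ℝ) < k := by exact_mod_cast hk
  have hα0 : 0 < α := by
    refine lt_of_le_of_lt (Finset.prod_nonneg fun i hi => ?_) hα
    rw [sub_nonneg, div_le_one hk']
    have : i + 1 ≤ k := by have := Finset.mem_range.1 hi; omega
    exact_mod_cast this
  -- Moving slightly below `1 / k` keeps the product under `α` and makes every factor `1 - i l` with
  -- `i ≤ k` strictly positive, including the one at `i = k`.
  obtain ⟨l, hl, hlα⟩ : ∃ l : ℝ, l < 1 / k ∧ ∏ i ∈ range b, (1 - ((i : ℝ) + 1) * l) < α := by
    have hc : Continuous fun l : ℝ => ∏ i ∈ range b, (1 - ((i : ℝ) + 1) * l) := by fun_prop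
    have hlt : (fun l : ℝ => ∏ i ∈ range b, (1 - ((i : ℝ) + 1) * l)) (1 / k) < α := by
      simpa [div_eq_mul_inv] using hα
    have hev := (hc.tendsto (1 / k : ℝ)).eventually_lt_const hlt
    have hev' := (hev.filter_mono nhdsWithin_le_nhds).and
      (self_mem_nhdsWithin (a := (1 / k : ℝ)) (s := Set.Iio (1 / k)))
    obtain ⟨l, h₁, h₂⟩ := hev'.exists
    exact ⟨l, h₂, h₁⟩
  have hfac : ∀ i : ℕ, i ≤ k → 0 < 1 - (i : ℝ) * l := by
    intro i hi
    rcases le_or_gt l 0 with h0 | h0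
    · have : (i : ℝ) * l ≤ 0 := mul_nonpos_of_nonneg_of_nonpos (by positivity) h0
      linarith
    · have h1 : (i : ℝ) * l ≤ k * l := by
        have : (i : ℝ) ≤ k := by exact_mod_cast hi
        gcongr
      have h2 : k * l < 1 := by
        rw [lt_div_iff₀ hk'] at hl
        linarith
      linarith
  refine ⟨α * ∏ i ∈ Finset.Ico (b + 1) (k + 1), (1 - (i : ℝ) * l),
    mul_pos hα0 (Finset.prod_pos fun i hi => hfac i ?_), ?_⟩
  · have := Finset.mem_Ico.1 hi; omega
  intro V _ _ G hG
  have hposb : ∀ s, s ≤ b + 1 → 0 < cliqueDensity G s := fun s hs =>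
    (hα0.trans_le hG).trans_le (cliqueDensity_antitone G hs)
  -- If all consecutive ratios up to `b` were below `1 - s l`, multiplying them would put the
  -- `K_{b+1}`-density below `α`. One good ratio then propagates upwards by
  -- `cliqueDensity_ratio_step`.
  obtain ⟨s₀, hs₁, hs₂, hs⟩ : ∃ s, 1 ≤ s ∧ s ≤ b ∧
      (1 - s * l) * cliqueDensity G s ≤ cliqueDensity G (s + 1) := by
    by_contra! hcon
    have : ∀ s, s ≤ b → cliqueDensity G (s + 1) ≤ ∏ i ∈ range s, (1 - ((i : ℝ) + 1) * l) := by
      intro s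
      induction s with
      | zero => intro _; simp [cliqueDensity_one]
      | succ s ih =>
        intro hsb
        rw [Finset.prod_range_succ]
        have h₁ := (hcon (s + 1) (by omega) hsb).le
        have h₂ := ih (by omega)
        have h₃ := hfac (s + 1) (by omega)
        push_cast at h₁ h₃
        calc _ ≤ (1 - ((s : ℝ) + 1) * l) * cliqueDensity G (s + 1) := h₁
          _ ≤ (1 - ((s : ℝ) + 1) * l) * ∏ i ∈ range s, (1 - ((i : ℝ) + 1) * l) := by gcongr
          _ = _ := mul_comm _ _
    exact absurd (hG.trans (this b le_rfl)) (not_le.2 hlα)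
  have hprop : ∀ s, s₀ ≤ s → s ≤ k → 0 < cliqueDensity G s ∧
      (1 - s * l) * cliqueDensity G s ≤ cliqueDensity G (s + 1) := by
    intro s hs₀
    induction s, hs₀ using Nat.le_induction with
    | base => exact fun _ => ⟨hposb _ (by omega), hs⟩
    | succ s hs₀ ih =>
      intro hsk
      obtain ⟨h₁, h₂⟩ := ih (by omega)
      refine ⟨lt_of_lt_of_le (mul_pos (hfac s (by omega)) h₁) h₂, ?_⟩
      have := cliqueDensity_ratio_step G (by omega : 1 ≤ s) h₁ h₂
      push_cast
      exact this
  have hfin : ∀ s, b + 1 ≤ s → s ≤ k + 1 →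
      α * ∏ i ∈ Finset.Ico (b + 1) s, (1 - (i : ℝ) * l) ≤ cliqueDensity G s := by
    intro s hs₀
    induction s, hs₀ using Nat.le_induction with
    | base => intro _; simpa using hG
    | succ s hs₀ ih =>
      intro hsk
      rw [Finset.prod_Ico_succ_top hs₀, ← mul_assoc, mul_comm]
      exact (mul_le_mul_of_nonneg_left (ih (by omega)) (hfac s (by omega)).le).trans
        (hprop s (by omega) (by omega)).2
  exact hfin (k + 1) (by omega) le_rfl

/-- Zykov's bound on the clique densities of `K_{k+1}`-free graphs. -/
theorem cliqueDensity_le_of_cliqueFree {b k : ℕ} (hk : 1 ≤ k) (hb : b ≤ k) [Nonempty V]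
    (hG : G.CliqueFree (k + 1)) :
    cliqueDensity G (b + 1) ≤ ∏ i ∈ range b, (1 - ((i : ℝ) + 1) / k) := by
  by_contra! h
  obtain ⟨c, hc, hsup⟩ := supersaturation hk hb h
  have := hsup G le_rfl
  rw [cliqueDensity, cliqueFree_iff_cliqueTuples.1 hG] at this
  simp at this
  linarith

end CliqueTuples

end HomThr

namespace HomThr

/-! ### Packing in set families of bounded VC dimension -/

section Packing

open scoped Classical
open Finset

/-- A random sample of `m` points separates all members of a family with large pairwise
symmetric differences. -/
theorem exists_separating_sample {Ω : Type} [Fintype Ω] [DecidableEq Ω] [Nonempty Ω] {c : ℝ} (hc1 : c ≤ 1)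
    (𝒜 : Finset (Finset Ω))
    (hsep : ∀ A ∈ 𝒜, ∀ B ∈ 𝒜, A ≠ B → c * Fintype.card Ω ≤ #(symmDiff A B)) {m : ℕ}
    (hm : (#𝒜 : ℝ) ^ 2 * (1 - c) ^ m < 1) :
    ∃ ω : Fin m → Ω, ∀ A ∈ 𝒜, ∀ B ∈ 𝒜, A ≠ B → ∃ i, ω i ∈ symmDiff A B := by
  by_contra! hcon
  -- Union bound: a sample that fails for a pair lies entirely in the complement of its symmetric
  -- difference.
  have hcover : (univ : Finset (Fin m → Ω)) ⊆ 𝒜.offDiag.biUnion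
      fun p => Fintype.piFinset fun _ : Fin m => (symmDiff p.1 p.2)ᶜ := by
    intro ω _
    obtain ⟨A, hA, B, hB, hAB, h⟩ := hcon ω
    rw [Finset.mem_biUnion]
    refine ⟨(A, B), Finset.mem_offDiag.2 ⟨hA, hB, hAB⟩, ?_⟩
    rw [Fintype.mem_piFinset]
    exact fun i => Finset.mem_compl.2 (h i)
  have hN : (0 : ℝ) < Fintype.card Ω := by exact_mod_cast Fintype.card_pos
  have hle : ((Fintype.card Ω : ℝ)) ^ m ≤
      ∑ p ∈ 𝒜.offDiag, ((1 - c) * Fintype.card Ω) ^ m := by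
    have h₁ := (Finset.card_le_card hcover).trans Finset.card_biUnion_le
    simp only [Finset.card_univ, Fintype.card_fun, Fintype.card_fin, Fintype.card_piFinset,
      Finset.prod_const] at h₁
    have h₂ : ((Fintype.card Ω : ℝ)) ^ m ≤
        ∑ p ∈ 𝒜.offDiag, (#(symmDiff p.1 p.2)ᶜ : ℝ) ^ m := by exact_mod_cast h₁
    refine h₂.trans (Finset.sum_le_sum fun p hp => ?_)
    obtain ⟨hA, hB, hAB⟩ := Finset.mem_offDiag.1 hp
    have h₃ := hsep _ hA _ hB hAB
    have h₄ : (#(symmDiff p.1 p.2)ᶜ : ℝ) = Fintype.card Ω - #(symmDiff p.1 p.2) := by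
      rw [Finset.card_compl, Nat.cast_sub (Finset.card_le_univ _)]
    gcongr
    rw [h₄]
    linarith
  have hoff : (#𝒜.offDiag : ℝ) ≤ (#𝒜 : ℝ) ^ 2 := by
    rw [Finset.offDiag_card, sq]
    exact_mod_cast Nat.sub_le _ _
  rw [Finset.sum_const, nsmul_eq_mul, mul_pow] at hle
  have h0 : 0 ≤ (1 - c) ^ m := pow_nonneg (by linarith) _
  have : (Fintype.card Ω : ℝ) ^ m < (Fintype.card Ω : ℝ) ^ m := by
    calc (Fintype.card Ω : ℝ) ^ m
        ≤ #𝒜.offDiag * ((1 - c) ^ m * (Fintype.card Ω : ℝ) ^ m) := hle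
      _ ≤ (#𝒜 : ℝ) ^ 2 * ((1 - c) ^ m * (Fintype.card Ω : ℝ) ^ m) := by gcongr
      _ = ((#𝒜 : ℝ) ^ 2 * (1 - c) ^ m) * (Fintype.card Ω : ℝ) ^ m := by ring
      _ < 1 * (Fintype.card Ω : ℝ) ^ m := by gcongr
      _ = _ := one_mul _
  exact lt_irrefl _ this

/-- Sauer–Shelah for the traces of a family on a finite set. -/
theorem card_le_of_injOn_inter {Ω : Type} [DecidableEq Ω] {d : ℕ} (𝒜 : Finset (Finset Ω))
    (hvc : ∀ T, 𝒜.Shatters T → #T ≤ d) (S : Finset Ω)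
    (hinj : Set.InjOn (fun A => S ∩ A) (𝒜 : Set (Finset Ω))) :
    #𝒜 ≤ (d + 1) * (#S + 1) ^ d := by
  -- Sets shattered by the traces lie in `S` and are shattered by `𝒜`, so they have at most `d`
  -- elements.
  have hsub : (𝒜.image fun A => S ∩ A).shatterer ⊆
      (range (d + 1)).biUnion fun k => powersetCard k S := by
    intro T hT
    rw [Finset.mem_shatterer] at hT
    have hTS : T ⊆ S := by
      obtain ⟨u, hu, h⟩ := hT.exists_superset
      obtain ⟨A, -, rfl⟩ := Finset.mem_image.1 hu
      exact h.trans Finset.inter_subset_left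
    have hT' : 𝒜.Shatters T := by
      intro t ht
      obtain ⟨u, hu, h⟩ := hT ht
      obtain ⟨A, hA, rfl⟩ := Finset.mem_image.1 hu
      refine ⟨A, hA, ?_⟩
      rw [← h, ← Finset.inter_assoc, Finset.inter_eq_left.2 hTS]
    rw [Finset.mem_biUnion]
    exact ⟨#T, Finset.mem_range.2 (Nat.lt_succ_of_le (hvc T hT')),
      Finset.mem_powersetCard.2 ⟨hTS, rfl⟩⟩
  calc #𝒜 = #(𝒜.image fun A => S ∩ A) := (Finset.card_image_of_injOn hinj).symm
    _ ≤ _ := Finset.card_le_card_shatterer _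
    _ ≤ _ := Finset.card_le_card hsub
    _ ≤ ∑ k ∈ range (d + 1), #(powersetCard k S) := Finset.card_biUnion_le
    _ ≤ ∑ _k ∈ range (d + 1), (#S + 1) ^ d := by
        refine Finset.sum_le_sum fun k hk => ?_
        rw [Finset.card_powersetCard]
        calc (#S).choose k ≤ #S ^ k := Nat.choose_le_pow _ _
          _ ≤ (#S + 1) ^ k := Nat.pow_le_pow_left (Nat.le_succ _) _
          _ ≤ (#S + 1) ^ d := Nat.pow_le_pow_right (Nat.succ_pos _)
              (Nat.lt_succ_iff.1 (Finset.mem_range.1 hk))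
    _ = _ := by simp

/-- A weak form of Haussler's packing lemma. -/
theorem exists_packing_bound (d : ℕ) {c : ℝ} (hc : 0 < c) :
    ∃ M : ℕ, ∀ {Ω : Type} [Fintype Ω] [DecidableEq Ω] (𝒜 : Finset (Finset Ω)),
      (∀ T, 𝒜.Shatters T → #T ≤ d) →
      (∀ A ∈ 𝒜, ∀ B ∈ 𝒜, A ≠ B → c * Fintype.card Ω ≤ #(symmDiff A B)) → #𝒜 ≤ M := by
  set c' : ℝ := min c (1 / 2) with hc'
  have hc0 : 0 < c' := lt_min hc (by norm_num)
  have hc1 : c' ≤ 1 / 2 := min_le_right _ _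
  obtain ⟨m, hm⟩ : ∃ m : ℕ,
      (((d + 1) * (m + 1) ^ d + 1 : ℕ) : ℝ) ^ 2 * (1 - c') ^ m < 1 := by
    have hlim : Tendsto (fun m : ℕ => (((m + 1 : ℕ) : ℝ) ^ (2 * d) * (1 - c') ^ (m + 1)))
        atTop (𝓝 0) :=
      (tendsto_add_atTop_iff_nat 1).2 (tendsto_pow_const_mul_const_pow_of_abs_lt_one (2 * d)
        (by rw [abs_of_nonneg (by linarith)]; linarith))
    -- The numerator cancels the extra power of `1 - c'` from the index shift; `(d + 2)^2` pays for
    -- the constants in the squared Sauer–Shelah bound.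
    have hpos : 0 < (1 - c') / ((d : ℝ) + 2) ^ 2 := by
      have : 0 < 1 - c' := by linarith
      positivity
    obtain ⟨m, hm⟩ := (hlim.eventually_lt_const hpos).exists
    refine ⟨m, ?_⟩
    rw [lt_div_iff₀ (by positivity), pow_succ (1 - c')] at hm
    have h1 : 0 < 1 - c' := by linarith
    have h2 : (((m + 1 : ℕ) : ℝ) ^ d * (d + 2)) ^ 2 * (1 - c') ^ m < 1 := by
      have : ((((m + 1 : ℕ) : ℝ) ^ d * (d + 2)) ^ 2 * (1 - c') ^ m) * (1 - c') <
          1 * (1 - c') := by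
        rw [one_mul]
        calc _ = ((m + 1 : ℕ) : ℝ) ^ (2 * d) * ((1 - c') ^ m * (1 - c')) * ((d : ℝ) + 2) ^ 2 := by
              ring
          _ < _ := hm
      exact lt_of_mul_lt_mul_right this h1.le
    refine lt_of_le_of_lt ?_ h2
    have h3 : (((d + 1) * (m + 1) ^ d + 1 : ℕ) : ℝ) ≤ ((m + 1 : ℕ) : ℝ) ^ d * (d + 2) := by
      have : 1 ≤ (m + 1) ^ d := Nat.one_le_pow _ _ (Nat.succ_pos _)
      have : (d + 1) * (m + 1) ^ d + 1 ≤ (m + 1) ^ d * (d + 2) := by nlinarith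
      exact_mod_cast this
    gcongr
  refine ⟨(d + 1) * (m + 1) ^ d, fun {Ω} _ _ 𝒜 hvc hsep => ?_⟩
  by_contra! hlt
  -- A subfamily of size exactly one above the bound: `m` sample points separate it, and
  -- Sauer–Shelah on those points contradicts its size.
  obtain ⟨ℬ, hℬ, hcard⟩ := Finset.exists_subset_card_eq (Nat.succ_le_of_lt hlt)
  rcases isEmpty_or_nonempty Ω with hΩ | hΩ
  · have h1 : #𝒜 ≤ 1 := Finset.card_le_one.2 fun A _ B _ => Subsingleton.elim A B
    have : 1 ≤ (d + 1) * (m + 1) ^ d := Nat.mul_pos (by omega) (by positivity)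
    omega
  · obtain ⟨ω, hω⟩ := exists_separating_sample (c := c') (m := m) (by linarith) ℬ
      (fun A hA B hB hAB => le_trans (by gcongr; exact min_le_left _ _)
        (hsep A (hℬ hA) B (hℬ hB) hAB)) (by rw [hcard]; exact hm)
    have hle := card_le_of_injOn_inter ℬ (fun T hT => hvc T (hT.mono_left hℬ)) (univ.image ω) (by
      intro A hA B hB hAB
      by_contra hne
      obtain ⟨i, hi⟩ := hω A hA B hB hne
      have hmem : ω i ∈ univ.image ω := Finset.mem_image_of_mem ω (mem_univ i)
      have := Finset.ext_iff.1 hAB (ω i)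
      simp only [Finset.mem_inter, hmem, true_and] at this
      rw [Finset.mem_symmDiff] at hi
      tauto)
    have hS : #(univ.image ω) ≤ m := Finset.card_image_le.trans (by simp)
    have : (d + 1) * (#(univ.image ω) + 1) ^ d ≤ (d + 1) * (m + 1) ^ d := by gcongr
    omega

end Packing

end HomThr

namespace HomThr

/-! ### Lifting cliques from a quotient graph -/

section Quotient

open scoped Classical
open Finset

theorem cliqueFree_of_hom {V W : Type} [Fintype V] [Fintype W] {G : SimpleGraph V}
    {F : SimpleGraph W} (φ : G →g F) {k : ℕ} (hF : F.CliqueFree k) : G.CliqueFree k := by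
  rw [cliqueFree_iff_cliqueTuples] at hF ⊢
  refine Finset.eq_empty_of_forall_notMem fun q hq => ?_
  have : (fun i => φ (q i)) ∈ cliqueTuples F k :=
    mem_cliqueTuples.2 fun i j hij => φ.map_adj (mem_cliqueTuples.1 hq i j hij)
  simp [hF] at this

/-- The image of a graph under a map of vertex sets. -/
def quotientGraph {V P : Type} (f : V → P) (G : SimpleGraph V) : SimpleGraph P where
  Adj p p' := p ≠ p' ∧ ∃ x y, f x = p ∧ f y = p' ∧ G.Adj x y
  symm := ⟨fun _ _ ⟨h, x, y, hx, hy, hxy⟩ => ⟨h.symm, y, x, hy, hx, hxy.symm⟩⟩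
  loopless := ⟨fun _ h => h.1 rfl⟩

/-- If the classes of a partition are singletons or large, and the pairs between classes joined by
an edge are all adjacent up to a relation of bounded degree, then cliques of the quotient lift. -/
theorem quotientGraph_cliqueFree {V P : Type} [Fintype V] [Fintype P] [DecidableEq P] {G : SimpleGraph V}
    {r D : ℕ} (f : V → P) (hf : Function.Surjective f) (B : V → V → Prop)
    (hB : ∀ x, #{y | B x y} ≤ D)
    (hadj : ∀ x y x' y', G.Adj x y → f x = f x' → f y = f y' → G.Adj x' y' ∨ B x' y')
    (hfib : ∀ p, (∀ x y, f x = p → f y = p → x = y) ∨ r * D < #{x | f x = p})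
    (hG : G.CliqueFree r) : (quotientGraph f G).CliqueFree r := by
  rw [cliqueFree_iff_cliqueTuples] at hG ⊢
  refine Finset.eq_empty_of_forall_notMem fun p hp => ?_
  rw [mem_cliqueTuples] at hp
  -- Representatives are corrected one index at a time. Singleton classes need no correction, as an
  -- edge between two of them is already an edge between the representatives.
  have key : ∀ s : Finset (Fin r), ∃ g : Fin r → V, (∀ i, f (g i) = p i) ∧
      ∀ i j, (i ∈ s ∨ ∀ x y, f x = p i → f y = p i → x = y) →
        (j ∈ s ∨ ∀ x y, f x = p j → f y = p j → x = y) → i ≠ j → G.Adj (g i) (g j) := by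
    intro s
    induction s using Finset.induction_on with
    | empty =>
      choose g hg using fun i => hf (p i)
      refine ⟨g, hg, fun i j hi hj hij => ?_⟩
      simp only [Finset.notMem_empty, false_or] at hi hj
      obtain ⟨-, x, y, hx, hy, hxy⟩ := hp i j hij
      rwa [hi _ _ (hg i) hx, hj _ _ (hg j) hy]
    | insert k s hk ih =>
      obtain ⟨g, hg, hgs⟩ := ih
      by_cases hsing : ∀ x y, f x = p k → f y = p k → x = y
      · refine ⟨g, hg, fun i j hi hj hij => hgs i j ?_ ?_ hij⟩
        · rcases hi with hi | hi
          · rcases Finset.mem_insert.1 hi with rfl | hi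
            exacts [Or.inr hsing, Or.inl hi]
          · exact Or.inr hi
        · rcases hj with hj | hj
          · rcases Finset.mem_insert.1 hj with rfl | hj
            exacts [Or.inr hsing, Or.inl hj]
          · exact Or.inr hj
      · have hbig := (hfib (p k)).resolve_left hsing
        -- A large class contains a vertex that is `B`-related to none of the current
        -- representatives.
        have hcard : #((univ : Finset (Fin r)).biUnion fun i => {y | B (g i) y}) ≤ r * D := by
          refine (Finset.card_biUnion_le_card_mul _ _ D fun i _ => hB (g i)).trans ?_
          simp
        obtain ⟨v, hv, hv'⟩ := Finset.exists_mem_notMem_of_card_lt_card (hcard.trans_lt hbig)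
        have hvk : f v = p k := (Finset.mem_filter.1 hv).2
        have hvB : ∀ i, ¬ B (g i) v := by
          intro i hi
          exact hv' (Finset.mem_biUnion.2 ⟨i, mem_univ _, by simpa using hi⟩)
        have hvadj : ∀ i, i ≠ k → G.Adj (g i) v := by
          intro i hi
          obtain ⟨-, x, y, hx, hy, hxy⟩ := hp i k hi
          exact (hadj x y (g i) v hxy (hx.trans (hg i).symm) (hy.trans hvk.symm)).resolve_right
            (hvB i)
        refine ⟨Function.update g k v, fun i => ?_, fun i j hi hj hij => ?_⟩
        · rcases eq_or_ne i k with rfl | hik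
          · simpa using hvk
          · simpa [hik] using hg i
        · rcases eq_or_ne i k with rfl | hik
          · rw [Function.update_self, Function.update_of_ne hij.symm]
            exact (hvadj j hij.symm).symm
          · rcases eq_or_ne j k with rfl | hjk
            · rw [Function.update_self, Function.update_of_ne hij]
              exact hvadj i hij
            · rw [Function.update_of_ne hik, Function.update_of_ne hjk]
              refine hgs i j ?_ ?_ hij
              · simpa [hik] using hi
              · simpa [hjk] using hj
  obtain ⟨g, -, hg⟩ := key univ
  have : g ∈ cliqueTuples G r := mem_cliqueTuples.2 fun i j hij =>
    hg i j (Or.inl (mem_univ _)) (Or.inl (mem_univ _)) hij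
  simp [hG] at this

end Quotient

/-! ### Clique links and the bounded target -/

section BoundedTarget

open scoped Classical
open Finset

/-- The ordered `t`-cliques in the neighbourhood of `u`. -/
noncomputable def cliqueLink {V : Type} [Fintype V] (G : SimpleGraph V) (t : ℕ) (u : V) :
    Finset (Fin t → V) :=
  {q ∈ cliqueTuples G t | ∀ i, G.Adj u (q i)}

/-- Two vertices that are equal, or non-adjacent and contained in no independent `a`-set. -/
def IsolatedPair {V : Type} (G : SimpleGraph V) (a : ℕ) (x y : V) : Prop :=
  x = y ∨ ¬ G.Adj x y ∧ ¬ ∃ I, G.IsNIndepSet a I ∧ x ∈ I ∧ y ∈ I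

/-- Every independent `a`-set has at least `c |V|^t` ordered `t`-cliques in its common
neighbourhood. -/
def RichCommonNbhds {V : Type} [Fintype V] (G : SimpleGraph V) (a t : ℕ) (c : ℝ) : Prop :=
  ∀ I, G.IsNIndepSet a I → c * (Fintype.card V : ℝ) ^ t ≤
    #{q ∈ cliqueTuples G t | ∀ i, q i ∈ commonNbhd G I}

variable {V : Type} [Fintype V] {G : SimpleGraph V} {a t : ℕ} {c : ℝ}

theorem mem_cliqueLink {u : V} {q : Fin t → V} :
    q ∈ cliqueLink G t u ↔ q ∈ cliqueTuples G t ∧ ∀ i, G.Adj u (q i) := by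
  simp [cliqueLink]

/-- A `t`-clique in both neighbourhoods would form a `K_{t+2}` with the edge `xy`. -/
theorem notMem_cliqueLink_of_adj (hG : G.CliqueFree (t + 2)) {x y : V} (hxy : G.Adj x y)
    {q : Fin t → V} (hx : q ∈ cliqueLink G t x) : q ∉ cliqueLink G t y := by
  intro hy
  rw [cliqueFree_iff_cliqueTuples] at hG
  rw [mem_cliqueLink] at hx hy
  have h₁ : ((0 : Fin (t + 1)).insertNth x q : Fin (t + 1) → V) ∈ cliqueTuples G (t + 1) :=
    insertNth_mem_cliqueTuples.2 ⟨hx.1, mem_tupleNbhd.2 hx.2⟩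
  have h₂ : ((0 : Fin (t + 2)).insertNth y ((0 : Fin (t + 1)).insertNth x q : Fin (t + 1) → V) :
      Fin (t + 2) → V) ∈ cliqueTuples G (t + 2) := by
    refine insertNth_mem_cliqueTuples.2 ⟨h₁, mem_tupleNbhd.2 fun i => ?_⟩
    induction i using Fin.cases with
    | zero => simpa using hxy.symm
    | succ i => simpa using hy.2 i
  simp [hG] at h₂

/-- Among too many partners of `x`, Ramsey finds an independent set of size `a - 1`, nonempty
because `a ≥ 2`. Adding `x` gives an independent `a`-set containing a supposedly isolated pair. -/
theorem exists_card_isolatedPair_le (t : ℕ) (ha : 2 ≤ a) : ∃ D : ℕ, ∀ {V : Type} [Fintype V]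
    {G : SimpleGraph V}, G.CliqueFree (t + 2) → ∀ x, #{y | IsolatedPair G a x y} ≤ D := by
  obtain ⟨R, hR⟩ := exists_ramsey (t + 2) (a - 1)
  refine ⟨R, fun {V} _ {G} hG x => ?_⟩
  by_contra! hlt
  have hcard : R ≤ #(({y | IsolatedPair G a x y} : Finset V).erase x) := by
    have := Finset.pred_card_le_card_erase (s := ({y | IsolatedPair G a x y} : Finset V)) (a := x)
    omega
  have hmem : ∀ y ∈ ({y | IsolatedPair G a x y} : Finset V).erase x, y ≠ x ∧ ¬ G.Adj x y ∧
      ¬ ∃ I, G.IsNIndepSet a I ∧ x ∈ I ∧ y ∈ I := by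
    intro y hy
    rw [Finset.mem_erase, Finset.mem_filter] at hy
    exact ⟨hy.1, hy.2.2.resolve_left (Ne.symm hy.1)⟩
  rcases hR G _ hcard with ⟨T, -, hT⟩ | ⟨T, hTs, hT⟩
  · exact hG T hT
  · have hne : T.Nonempty := by
      rw [← Finset.card_pos, hT.card_eq]; omega
    obtain ⟨y, hy⟩ := hne
    refine (hmem y (hTs hy)).2.2 ⟨insert x T, ?_, by simp, by simp [hy]⟩
    rw [← SimpleGraph.isNClique_compl] at hT ⊢
    have := hT.insert (a := x) fun b hb => ⟨(hmem b (hTs hb)).1.symm, (hmem b (hTs hb)).2.1⟩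
    rwa [Nat.sub_add_cancel (by omega)] at this

theorem le_card_inter_cliqueLink (hc : RichCommonNbhds G a t c) {x y : V} (hxy : ¬ G.Adj x y)
    (hgood : ¬ IsolatedPair G a x y) :
    c * (Fintype.card V : ℝ) ^ t ≤ #(cliqueLink G t x ∩ cliqueLink G t y) := by
  obtain ⟨I, hI, hx, hy⟩ : ∃ I, G.IsNIndepSet a I ∧ x ∈ I ∧ y ∈ I := by
    by_contra h
    exact hgood (Or.inr ⟨hxy, h⟩)
  refine (hc I hI).trans ?_
  have : #{q ∈ cliqueTuples G t | ∀ i, q i ∈ commonNbhd G I} ≤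
      #(cliqueLink G t x ∩ cliqueLink G t y) := by
    refine Finset.card_le_card fun q hq => ?_
    rw [Finset.mem_filter] at hq
    rw [Finset.mem_inter, mem_cliqueLink, mem_cliqueLink]
    exact ⟨⟨hq.1, fun i => hq.2 i x hx⟩, ⟨hq.1, fun i => hq.2 i y hy⟩⟩
  exact_mod_cast this

/-- The intersections of the links of `x i` and `y i` are pairwise disjoint, because `y i` is
adjacent to `x j` for `j < i`. Each has at least `c |V|^t` elements, and there are only `|V|^t`
tuples. -/
theorem chain_length_le [Nonempty V] (hG : G.CliqueFree (t + 2)) (hc : RichCommonNbhds G a t c)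
    {d : ℕ} (x y : Fin d → V) (hxy : ∀ i, ¬ G.Adj (x i) (y i))
    (hgood : ∀ i, ¬ IsolatedPair G a (x i) (y i)) (hadj : ∀ i j, j < i → G.Adj (y i) (x j)) :
    d * c ≤ 1 := by
  have hN : (0 : ℝ) < (Fintype.card V : ℝ) ^ t := by
    have : (0 : ℝ) < Fintype.card V := by exact_mod_cast Fintype.card_pos
    positivity
  have hdisj : ∀ i j, j < i → Disjoint (cliqueLink G t (x i) ∩ cliqueLink G t (y i))
      (cliqueLink G t (x j) ∩ cliqueLink G t (y j)) := by
    intro i j hij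
    rw [Finset.disjoint_left]
    intro q hq hq'
    exact notMem_cliqueLink_of_adj hG (hadj i j hij) (Finset.mem_inter.1 hq).2
      (Finset.mem_inter.1 hq').1
  have hpd : Set.PairwiseDisjoint ((univ : Finset (Fin d)) : Set (Fin d))
      fun i => cliqueLink G t (x i) ∩ cliqueLink G t (y i) := by
    intro i _ j _ hij
    rcases lt_or_gt_of_ne hij with h | h
    · exact (hdisj j i h).symm
    · exact hdisj i j h
  have h₁ := Finset.card_le_univ
    ((univ : Finset (Fin d)).biUnion fun i => cliqueLink G t (x i) ∩ cliqueLink G t (y i))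
  rw [Finset.card_biUnion hpd] at h₁
  simp only [Fintype.card_fun, Fintype.card_fin] at h₁
  have h₂ : (∑ i : Fin d, (#(cliqueLink G t (x i) ∩ cliqueLink G t (y i)) : ℝ)) ≤
      (Fintype.card V : ℝ) ^ t := by exact_mod_cast h₁
  have h₃ : ∑ _i : Fin d, c * (Fintype.card V : ℝ) ^ t ≤ (Fintype.card V : ℝ) ^ t :=
    (Finset.sum_le_sum fun i _ => le_card_inter_cliqueLink hc (hxy i) (hgood i)).trans h₂
  simp only [Finset.sum_const, Finset.card_univ, Fintype.card_fin, nsmul_eq_mul] at h₃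
  rw [← mul_assoc] at h₃
  exact le_of_mul_le_mul_right (by simpa using h₃) hN

/-- The clique links have bounded VC dimension. -/
theorem card_lt_of_shatters_cliqueLink (hG : G.CliqueFree (t + 2)) (hc : RichCommonNbhds G a t c)
    {D : ℕ} (hD : ∀ x, #{y | IsolatedPair G a x y} ≤ D) {d L : ℕ} (hd : 1 < d * c)
    (hL : t * D < 2 ^ L) {T : Finset (Fin t → V)}
    (hT : ((univ : Finset V).image (cliqueLink G t)).Shatters T) : #T < d + L := by
  by_contra! hle
  have hsh : ∀ S ⊆ T, ∃ u, T ∩ cliqueLink G t u = S := by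
    intro S hS
    obtain ⟨A, hA, h⟩ := hT hS
    obtain ⟨u, -, rfl⟩ := Finset.mem_image.1 hA
    exact ⟨u, h⟩
  obtain ⟨u₀, hu₀⟩ := hsh T subset_rfl
  have hV : Nonempty V := ⟨u₀⟩
  have hclique : ∀ q ∈ T, q ∈ cliqueTuples G t := by
    intro q hq
    rw [← hu₀] at hq
    exact (mem_cliqueLink.1 (Finset.mem_inter.1 hq).2).1
  -- The `d` tuples in `T₁` index the chain; the other `L` or more only supply freedom in the choice
  -- of `y`.
  obtain ⟨T₁, hT₁, hcard⟩ := Finset.exists_subset_card_eq (by omega : d ≤ #T)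
  have hU : L ≤ #(T \ T₁) := by
    rw [Finset.card_sdiff_of_subset hT₁]; omega
  let e := (T₁.equivFinOfCardEq hcard).symm
  have hpick : ∀ i : Fin d, ∃ y l, (∀ j, j < i → (e j).1 ∈ cliqueLink G t y) ∧
      ¬ G.Adj ((e i).1 l) y ∧ ¬ IsolatedPair G a ((e i).1 l) y := by
    intro i
    let pre : Finset (Fin t → V) := ({j | j < i} : Finset (Fin d)).image fun j => (e j).1
    have hpre : pre ⊆ T₁ := by
      intro q hq
      obtain ⟨j, -, rfl⟩ := Finset.mem_image.1 hq
      exact (e j).2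
    -- Each `y W` has the earlier tuples in its link but not the `i`-th. Varying `W` gives at least
    -- `2 ^ L > t * D` distinct vertices, so one forms no isolated pair with any entry of the `i`-th
    -- tuple.
    choose! y hy using fun (W : Finset (Fin t → V)) (hW : W ⊆ T \ T₁) => hsh (pre ∪ W)
      (Finset.union_subset (hpre.trans hT₁) (hW.trans Finset.sdiff_subset))
    have hinj : Set.InjOn y ((T \ T₁).powerset : Set (Finset (Fin t → V))) := by
      intro W hW W' hW' h
      rw [Finset.mem_coe, Finset.mem_powerset] at hW hW'
      have h₁ : pre ∪ W = pre ∪ W' := by rw [← hy W hW, ← hy W' hW', h]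
      have h₂ : ∀ Z ⊆ T \ T₁, (pre ∪ Z) \ T₁ = Z := by
        intro Z hZ
        ext q
        have := @hpre q
        have := @hZ q
        simp only [Finset.mem_sdiff, Finset.mem_union] at *
        tauto
      rw [← h₂ W hW, ← h₂ W' hW', h₁]
    have hbad : #((univ : Finset (Fin t)).biUnion fun l =>
        {y | IsolatedPair G a ((e i).1 l) y}) ≤ t * D := by
      refine (Finset.card_biUnion_le_card_mul _ _ D fun l _ => hD _).trans ?_
      simp
    have himg : t * D < #((T \ T₁).powerset.image y) := by
      rw [Finset.card_image_of_injOn hinj, Finset.card_powerset]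
      exact hL.trans_le (Nat.pow_le_pow_right (by norm_num) hU)
    obtain ⟨v, hv, hv'⟩ := Finset.exists_mem_notMem_of_card_lt_card (hbad.trans_lt himg)
    obtain ⟨W, hW, rfl⟩ := Finset.mem_image.1 hv
    rw [Finset.mem_powerset] at hW
    have hyW := hy W hW
    have hnot : (e i).1 ∉ cliqueLink G t (y W) := by
      intro h
      have h₁ : (e i).1 ∈ pre ∪ W := by
        rw [← hyW]
        exact Finset.mem_inter.2 ⟨hT₁ (e i).2, h⟩
      rcases Finset.mem_union.1 h₁ with h₂ | h₂
      · obtain ⟨j, hj, hji⟩ := Finset.mem_image.1 h₂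
        have := e.injective (Subtype.ext hji)
        rw [Finset.mem_filter, this] at hj
        exact lt_irrefl _ hj.2
      · exact (Finset.mem_sdiff.1 (hW h₂)).2 (e i).2
    have hex : ∃ l, ¬ G.Adj (y W) ((e i).1 l) := by
      by_contra! h
      exact hnot (mem_cliqueLink.2 ⟨hclique _ (hT₁ (e i).2), h⟩)
    obtain ⟨l, hl⟩ := hex
    refine ⟨y W, l, fun j hj => ?_, fun h => hl h.symm, fun h => ?_⟩
    · have h₁ : (e j).1 ∈ pre ∪ W :=
        Finset.mem_union_left _ (Finset.mem_image.2 ⟨j, by simpa using hj, rfl⟩)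
      rw [← hyW] at h₁
      exact (Finset.mem_inter.1 h₁).2
    · exact hv' (Finset.mem_biUnion.2 ⟨l, mem_univ _, by simpa using h⟩)
  choose y l h₁ h₂ h₃ using hpick
  have := chain_length_le hG hc (fun i => (e i).1 (l i)) y h₂ h₃
    fun i j hij => (mem_cliqueLink.1 (h₁ i j hij)).2 _
  linarith

/-- A maximal separated set of vertices, with respect to the distance of their clique links. -/
theorem exists_separated_net [Nonempty V] (G : SimpleGraph V) (t : ℕ) {c : ℝ} (hc : 0 < c) :
    ∃ U : Finset V, (∀ x ∈ U, ∀ y ∈ U, x ≠ y → c * (Fintype.card V : ℝ) ^ t ≤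
        #(symmDiff (cliqueLink G t x) (cliqueLink G t y))) ∧
      ∀ v, ∃ u ∈ U, (#(symmDiff (cliqueLink G t v) (cliqueLink G t u)) : ℝ) <
        c * (Fintype.card V : ℝ) ^ t := by
  have hN : (0 : ℝ) < (Fintype.card V : ℝ) ^ t := by
    have : (0 : ℝ) < Fintype.card V := by exact_mod_cast Fintype.card_pos
    positivity
  let sep : Finset V → Prop := fun U => ∀ x ∈ U, ∀ y ∈ U, x ≠ y →
    c * (Fintype.card V : ℝ) ^ t ≤ #(symmDiff (cliqueLink G t x) (cliqueLink G t y))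
  obtain ⟨U, hU, hmax⟩ := Finset.exists_max_image ({U | sep U} : Finset (Finset V)) Finset.card
    -- A separated set of maximum size is a net: a vertex far from all its members could be added.
    ⟨∅, by simp [sep]⟩
  have hUs : sep U := (Finset.mem_filter.1 hU).2
  refine ⟨U, hUs, fun v => ?_⟩
  by_contra! hcon
  have hv : v ∉ U := by
    intro hv
    have := hcon v hv
    simp only [symmDiff_self, Finset.bot_eq_empty, Finset.card_empty, Nat.cast_zero] at this
    have := mul_pos hc hN
    linarith
  have hins : sep (insert v U) := by
    intro x hx y hy hxy
    rcases Finset.mem_insert.1 hx with rfl | hx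
    · rcases Finset.mem_insert.1 hy with rfl | hy
      · exact absurd rfl hxy
      · exact hcon y hy
    · rcases Finset.mem_insert.1 hy with rfl | hy
      · rw [symmDiff_comm]
        exact hcon x (by assumption)
      · exact hUs x hx y hy hxy
  have := hmax (insert v U) (by simpa using hins)
  rw [Finset.card_insert_of_notMem hv] at this
  omega

/-- The links of `x` and `y` are disjoint, so a tuple common to the links of `x'` and `y'` must lie
in one of the four small symmetric differences. -/
theorem card_inter_cliqueLink_lt (hG : G.CliqueFree (t + 2)) {x y x' y' u v : V}
    (hxy : G.Adj x y) {δ : ℝ}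
    (hx : (#(symmDiff (cliqueLink G t x) (cliqueLink G t u)) : ℝ) < δ)
    (hx' : (#(symmDiff (cliqueLink G t x') (cliqueLink G t u)) : ℝ) < δ)
    (hy : (#(symmDiff (cliqueLink G t y) (cliqueLink G t v)) : ℝ) < δ)
    (hy' : (#(symmDiff (cliqueLink G t y') (cliqueLink G t v)) : ℝ) < δ) :
    (#(cliqueLink G t x' ∩ cliqueLink G t y') : ℝ) < 4 * δ := by
  have hsub : cliqueLink G t x' ∩ cliqueLink G t y' ⊆
      (symmDiff (cliqueLink G t x) (cliqueLink G t u) ∪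
        symmDiff (cliqueLink G t x') (cliqueLink G t u)) ∪
      (symmDiff (cliqueLink G t y) (cliqueLink G t v) ∪
        symmDiff (cliqueLink G t y') (cliqueLink G t v)) := by
    intro q hq
    have hne := fun h : q ∈ cliqueLink G t x => notMem_cliqueLink_of_adj hG hxy h
    rw [Finset.mem_inter] at hq
    rw [Finset.mem_union, Finset.mem_union, Finset.mem_union, Finset.mem_symmDiff,
      Finset.mem_symmDiff, Finset.mem_symmDiff, Finset.mem_symmDiff]
    by_cases h₁ : q ∈ cliqueLink G t u
    · by_cases h₂ : q ∈ cliqueLink G t x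
      · by_cases h₃ : q ∈ cliqueLink G t v
        · exact Or.inr (Or.inl (Or.inr ⟨h₃, hne h₂⟩))
        · exact Or.inr (Or.inr (Or.inl ⟨hq.2, h₃⟩))
      · exact Or.inl (Or.inl (Or.inr ⟨h₁, h₂⟩))
    · exact Or.inl (Or.inr (Or.inl ⟨hq.1, h₁⟩))
  have h₁ := (Finset.card_le_card hsub).trans (Finset.card_union_le _ _)
  have h₂ := Finset.card_union_le (symmDiff (cliqueLink G t x) (cliqueLink G t u))
    (symmDiff (cliqueLink G t x') (cliqueLink G t u))
  have h₃ := Finset.card_union_le (symmDiff (cliqueLink G t y) (cliqueLink G t v))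
    (symmDiff (cliqueLink G t y') (cliqueLink G t v))
  have h₄ := h₁.trans (Nat.add_le_add h₂ h₃)
  have h₅ : (#(cliqueLink G t x' ∩ cliqueLink G t y') : ℝ) ≤
      (#(symmDiff (cliqueLink G t x) (cliqueLink G t u)) +
        #(symmDiff (cliqueLink G t x') (cliqueLink G t u))) +
      (#(symmDiff (cliqueLink G t y) (cliqueLink G t v)) +
        #(symmDiff (cliqueLink G t y') (cliqueLink G t v))) := by exact_mod_cast h₄
  linarith

/-- A `K_{t+2}`-free graph in which all independent `a`-sets have many `K_t` in their common
neighbourhood is homomorphic to a `K_{t+2}`-free graph of bounded size. -/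
theorem exists_bounded_target (t : ℕ) (ha : 2 ≤ a) (hc : 0 < c) :
    ∃ M : ℕ, ∀ {V : Type} [Fintype V] {G : SimpleGraph V}, G.CliqueFree (t + 2) →
      RichCommonNbhds G a t c → ∃ m ≤ M, ∃ F : SimpleGraph (Fin m),
        F.CliqueFree (t + 2) ∧ Nonempty (G →g F) := by
  obtain ⟨D, hD⟩ := exists_card_isolatedPair_le t ha
  obtain ⟨R, hR⟩ := exists_ramsey (t + 2) a
  obtain ⟨d, hd⟩ : ∃ d : ℕ, 1 < d * c := by
    obtain ⟨d, hd⟩ := exists_nat_gt (1 / c)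
    exact ⟨d, by rwa [div_lt_iff₀ hc] at hd⟩
  obtain ⟨L, hL⟩ : ∃ L : ℕ, t * D < 2 ^ L := ⟨t * D, Nat.lt_two_pow_self⟩
  -- With radius `c / 4`, four symmetric differences stay strictly below the overlap `c` of a
  -- non-adjacent, non-isolated pair.
  obtain ⟨M, hM⟩ := exists_packing_bound (d + L) (c := c / 4) (by positivity)
  -- The bound `R` yields an independent `a`-set in a large class; `(t + 2) * D` is the class size
  -- needed to lift cliques.
  set K := max R ((t + 2) * D) with hK
  refine ⟨M + K * M, fun {V} _ {G} hG hrich => ?_⟩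
  rcases isEmpty_or_nonempty V with hV | hV
  · exact ⟨0, Nat.zero_le _, ⊥, SimpleGraph.cliqueFree_of_card_lt (by simp),
      ⟨⟨fun v => isEmptyElim v, fun {v} => isEmptyElim v⟩⟩⟩
  have hN : (0 : ℝ) < (Fintype.card V : ℝ) ^ t := by
    have : (0 : ℝ) < Fintype.card V := by exact_mod_cast Fintype.card_pos
    positivity
  obtain ⟨U, hsep, hnet⟩ := exists_separated_net G t (c := c / 4) (by positivity)
  have hUM : #U ≤ M := by
    have hinj : Set.InjOn (cliqueLink G t) (U : Set V) := by
      intro x hx y hy hxy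
      by_contra hne
      have := hsep x hx y hy hne
      rw [hxy] at this
      simp only [symmDiff_self, Finset.bot_eq_empty, Finset.card_empty, Nat.cast_zero] at this
      have : 0 < c / 4 * (Fintype.card V : ℝ) ^ t := by positivity
      linarith
    rw [← Finset.card_image_of_injOn hinj]
    refine hM _ (fun T hT => ?_) ?_
    · exact (card_lt_of_shatters_cliqueLink hG hrich (hD hG) hd hL
        (hT.mono_left (Finset.image_subset_image (Finset.subset_univ U)))).le
    · intro A hA B hB hAB
      obtain ⟨x, hx, rfl⟩ := Finset.mem_image.1 hA
      obtain ⟨y, hy, rfl⟩ := Finset.mem_image.1 hB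
      have := hsep x hx y hy fun h => hAB (h ▸ rfl)
      simpa using this
  choose ρ hρU hρ using hnet
  have hpair : ∀ x y x' y', G.Adj x y → ρ x = ρ x' → ρ y = ρ y' →
      G.Adj x' y' ∨ IsolatedPair G a x' y' := by
    intro x y x' y' hxy hx hy
    by_contra! hcon
    have h₁ := le_card_inter_cliqueLink hrich hcon.1 hcon.2
    have h₂ := card_inter_cliqueLink_lt hG hxy (hρ x) (hx ▸ hρ x') (hρ y) (hy ▸ hρ y')
    linarith
  -- Large classes collapse to their centre; small classes are split into singletons.
  let f : V → V ⊕ V := fun v => if K < #{w | ρ w = ρ v} then Sum.inl (ρ v) else Sum.inr v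
  have hf : ∀ v, (f v = Sum.inl (ρ v) ∧ K < #{w | ρ w = ρ v}) ∨
      (f v = Sum.inr v ∧ #{w | ρ w = ρ v} ≤ K) := by
    intro v
    by_cases h : K < #{w | ρ w = ρ v}
    · exact Or.inl ⟨if_pos h, h⟩
    · exact Or.inr ⟨if_neg h, not_lt.1 h⟩
  have hfρ : ∀ x y, f x = f y → ρ x = ρ y := by
    intro x y h
    rcases hf x with ⟨hx, -⟩ | ⟨hx, -⟩ <;> rcases hf y with ⟨hy, -⟩ | ⟨hy, -⟩ <;>
      rw [hx, hy] at h
    · exact Sum.inl_injective h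
    · cases h
    · cases h
    · rw [Sum.inr_injective h]
  let P := {p // p ∈ (univ : Finset V).image f}
  let g : V → P := fun v => ⟨f v, Finset.mem_image_of_mem f (mem_univ v)⟩
  have hgf : ∀ x y, g x = g y → f x = f y := fun x y h => congrArg Subtype.val h
  have hg : Function.Surjective g := by
    rintro ⟨p, hp⟩
    obtain ⟨v, -, rfl⟩ := Finset.mem_image.1 hp
    exact ⟨v, rfl⟩
  have hfree : (quotientGraph g G).CliqueFree (t + 2) := by
    refine quotientGraph_cliqueFree g hg (IsolatedPair G a) (hD hG) ?_ ?_ hG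
    · exact fun x y x' y' hxy hx hy =>
        hpair x y x' y' hxy (hfρ _ _ (hgf _ _ hx)) (hfρ _ _ (hgf _ _ hy))
    · intro p
      obtain ⟨v, rfl⟩ := hg p
      rcases hf v with ⟨hv, hbig⟩ | ⟨hv, -⟩
      · right
        refine ((le_max_right _ _).trans_lt hbig).trans_le (Finset.card_le_card fun w hw => ?_)
        have hw' : ρ w = ρ v := (Finset.mem_filter.1 hw).2
        refine Finset.mem_filter.2 ⟨mem_univ _, Subtype.ext ?_⟩
        change f w = f v
        rw [hv]
        change (if K < #{w' | ρ w' = ρ w} then Sum.inl (ρ w) else Sum.inr w) = Sum.inl (ρ v)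
        rw [hw', if_pos hbig]
      · left
        have : ∀ x, g x = g v → x = v := by
          intro x hx
          have h := hgf _ _ hx
          rw [hv] at h
          rcases hf x with ⟨h', -⟩ | ⟨h', -⟩
          · rw [h'] at h; cases h
          · rw [h'] at h; exact Sum.inr_injective h
        intro x y hx hy
        rw [this x hx, this y hy]
  -- The quotient discards loops, so no edge may collapse. An edge inside a large class would make
  -- every pair in it adjacent or isolated, contradicting its independent `a`-set.
  have hloop : ∀ x y, G.Adj x y → g x ≠ g y := by
    intro x y hxy h
    have hfxy := hgf _ _ h
    have hρxy := hfρ _ _ hfxy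
    rcases hf x with ⟨hx, hbig⟩ | ⟨hx, -⟩
    · rcases hR G _ ((le_max_left _ _).trans hbig.le) with ⟨T, -, hT⟩ | ⟨T, hTs, hT⟩
      · exact hG T hT
      · obtain ⟨x', hx', y', hy', hne⟩ := Finset.one_lt_card.1 (by rw [hT.card_eq]; omega : 1 < #T)
        have e₁ : ρ x' = ρ x := (Finset.mem_filter.1 (hTs hx')).2
        have e₂ : ρ y' = ρ x := (Finset.mem_filter.1 (hTs hy')).2
        rcases hpair x y x' y' hxy e₁.symm (hρxy ▸ e₂.symm) with h' | h' | h'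
        · exact hT.1 hx' hy' hne h'
        · exact hne h'
        · exact h'.2 ⟨T, hT, hx', hy'⟩
    · rw [hx] at hfxy
      rcases hf y with ⟨hy, -⟩ | ⟨hy, -⟩
      · rw [hy] at hfxy; cases hfxy
      · rw [hy] at hfxy
        exact hxy.ne (Sum.inr_injective hfxy)
  have hcardP : Fintype.card P ≤ M + K * M := by
    have hsub : (univ : Finset V).image f ⊆ U.image Sum.inl ∪
        ({v | #{w | ρ w = ρ v} ≤ K} : Finset V).image Sum.inr := by
      intro p hp
      obtain ⟨v, -, rfl⟩ := Finset.mem_image.1 hp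
      rcases hf v with ⟨hv, -⟩ | ⟨hv, hs⟩
      · rw [hv]
        exact Finset.mem_union_left _ (Finset.mem_image_of_mem _ (hρU v))
      · rw [hv]
        exact Finset.mem_union_right _ (Finset.mem_image_of_mem _ (by simpa using hs))
    have hsmall : #({v | #{w | ρ w = ρ v} ≤ K} : Finset V) ≤ K * #U := by
      refine Finset.card_le_mul_card_image_of_maps_to (f := ρ) (fun v _ => hρU v) K fun u _ => ?_
      rcases Finset.eq_empty_or_nonempty
        ({v ∈ ({v | #{w | ρ w = ρ v} ≤ K} : Finset V) | ρ v = u} : Finset V) with h | ⟨v, hv⟩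
      · rw [h]; simp
      · simp only [Finset.mem_filter, mem_univ, true_and] at hv
        obtain ⟨hv, rfl⟩ := hv
        refine le_trans (Finset.card_le_card fun w hw => ?_) hv
        simp only [Finset.mem_filter, mem_univ, true_and] at hw ⊢
        exact hw.2
    calc Fintype.card P = #((univ : Finset V).image f) := Fintype.card_coe _
      _ ≤ _ := Finset.card_le_card hsub
      _ ≤ _ := Finset.card_union_le _ _
      _ ≤ #U + K * #U := Nat.add_le_add Finset.card_image_le (Finset.card_image_le.trans hsmall)
      _ ≤ M + K * M := by gcongr
  let e := Fintype.equivFin P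
  refine ⟨Fintype.card P, hcardP, (quotientGraph g G).comap e.symm, ?_, ?_⟩
  · exact cliqueFree_of_hom (F := quotientGraph g G) ⟨e.symm, fun h => h⟩ hfree
  · refine ⟨⟨fun v => e (g v), fun {x y} hxy => ?_⟩⟩
    rw [SimpleGraph.comap_adj, e.symm_apply_apply, e.symm_apply_apply]
    exact ⟨hloop x y hxy, x, y, rfl, rfl, hxy⟩

end BoundedTarget

end HomThr

namespace HomThr

/-! ### Shift graphs and the extremal multipartite construction -/

section Multipartite

open scoped Classical
open Finset

/-- Shift graphs: triangle-free graphs with no homomorphism to a small complete graph. -/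
theorem exists_triangleFree_not_colorable (m : ℕ) : ∃ (p : ℕ) (B : SimpleGraph (Fin p)),
    B.CliqueFree 3 ∧ ∀ φ : Fin p → Fin m, ∃ x y, B.Adj x y ∧ φ x = φ y := by
  let n := 2 ^ m + 1
  let S : SimpleGraph (Fin n × Fin n) :=
    { Adj := fun p q => (p.1 < p.2 ∧ p.2 = q.1 ∧ q.1 < q.2) ∨ (q.1 < q.2 ∧ q.2 = p.1 ∧ p.1 < p.2)
      symm := ⟨fun _ _ h => h.symm⟩
      loopless := ⟨fun p h => by
        rcases h with ⟨h₁, h₂, -⟩ | ⟨h₁, h₂, -⟩ <;> exact h₁.ne h₂.symm⟩ }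
  have hfree : S.CliqueFree 3 := by
    intro s hs
    rw [SimpleGraph.is3Clique_iff] at hs
    obtain ⟨⟨a, a'⟩, ⟨b, b'⟩, ⟨c, c'⟩, hab, hac, hbc, -⟩ := hs
    simp only [S, Fin.lt_def, Fin.ext_iff] at hab hac hbc
    omega
  have hcol : ∀ φ : Fin n × Fin n → Fin m, ∃ x y, S.Adj x y ∧ φ x = φ y := by
    intro φ
    -- Two of the `2 ^ m + 1` indices have the same set of colours on their outgoing pairs. For `i <
    -- j`, the colour of `(i, j)` then recurs on some `(j, l)`, an adjacent vertex.
    obtain ⟨i, j, hij, h⟩ := Fintype.exists_ne_map_eq_of_card_lt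
      (fun i : Fin n => ({i' | i < i'} : Finset (Fin n)).image fun i' => φ (i, i')) (by simp [n])
    wlog hlt : i < j generalizing i j
    · exact this j i hij.symm h.symm (lt_of_le_of_ne (not_lt.1 hlt) hij.symm)
    have hmem : φ (i, j) ∈ ({i' | i < i'} : Finset (Fin n)).image fun i' => φ (i, i') :=
      Finset.mem_image.2 ⟨j, by simpa using hlt, rfl⟩
    simp only [h, Finset.mem_image, Finset.mem_filter, mem_univ, true_and] at hmem
    obtain ⟨l, hl, hφ⟩ := hmem
    exact ⟨(i, j), (j, l), Or.inl ⟨hlt, rfl, hl⟩, hφ.symm⟩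
  let e := Fintype.equivFin (Fin n × Fin n)
  refine ⟨_, S.comap e.symm, cliqueFree_of_hom (F := S) ⟨e.symm, fun h => h⟩ hfree, fun φ => ?_⟩
  obtain ⟨x, y, hxy, h⟩ := hcol fun v => φ (e v)
  exact ⟨e x, e y, by simpa using hxy, h⟩

/-- A graph containing a complete multipartite graph has many ordered cliques. -/
theorem descFactorial_mul_pow_le_card_cliqueTuples {V κ : Type} [Fintype V] [Fintype κ]
    {G : SimpleGraph V} {N : ℕ} (e : κ × Fin N → V) (he : Function.Injective e)
    (hadj : ∀ i j x y, i ≠ j → G.Adj (e (i, x)) (e (j, y))) (b : ℕ) :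
    (Fintype.card κ).descFactorial b * N ^ b ≤ #(cliqueTuples G b) := by
  have hcard : Fintype.card ((Fin b ↪ κ) × (Fin b → Fin N)) =
      (Fintype.card κ).descFactorial b * N ^ b := by
    simp [Fintype.card_embedding_eq]
  rw [← hcard, ← Finset.card_univ]
  refine Finset.card_le_card_of_injOn (fun p i => e (p.1 i, p.2 i)) ?_ ?_
  · intro p _
    exact mem_cliqueTuples.2 fun i j hij => hadj _ _ _ _ fun h => hij (p.1.injective h)
  · rintro ⟨σ, u⟩ _ ⟨σ', u'⟩ _ h
    have h' : ∀ i, (σ i, u i) = (σ' i, u' i) := fun i => he (congrFun h i)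
    refine Prod.ext ?_ ?_
    · ext i
      exact (Prod.ext_iff.1 (h' i)).1
    · funext i
      exact (Prod.ext_iff.1 (h' i)).2

/-- The part of a vertex of the balanced multipartite graph. -/
def partOf {k N : ℕ} (v : Fin ((k + 1) * N)) : Fin (k + 1) := (finProdFinEquiv.symm v).1

theorem partOf_finProdFinEquiv {k N : ℕ} (x : Fin (k + 1) × Fin N) :
    partOf (finProdFinEquiv x) = x.1 := by
  rw [partOf, Equiv.symm_apply_apply]

/-- The embedding of `Fin p` in the first part. -/
def firstPart (k : ℕ) {N p : ℕ} (h : p ≤ N) (i : Fin p) : Fin ((k + 1) * N) :=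
  finProdFinEquiv (0, Fin.castLE h i)

theorem partOf_firstPart {k N p : ℕ} (h : p ≤ N) (i : Fin p) : partOf (firstPart k h i) = 0 :=
  partOf_finProdFinEquiv _

theorem firstPart_injective {k N p : ℕ} (h : p ≤ N) : Function.Injective (firstPart k h) := by
  intro i j hij
  have := (Prod.ext_iff.1 (finProdFinEquiv.injective hij)).2
  exact Fin.castLE_injective h this

/-- The complete `(k+1)`-partite graph with parts of size `N` and a graph placed in the first
part. -/
def multipartiteWith (k : ℕ) {N p : ℕ} (B : SimpleGraph (Fin p)) (h : p ≤ N) :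
    SimpleGraph (Fin ((k + 1) * N)) where
  Adj x y := partOf x ≠ partOf y ∨ ∃ i j, B.Adj i j ∧ firstPart k h i = x ∧ firstPart k h j = y
  symm := ⟨fun x y hxy => by
    rcases hxy with hxy | ⟨i, j, hij, hi, hj⟩
    exacts [Or.inl hxy.symm, Or.inr ⟨j, i, hij.symm, hj, hi⟩]⟩
  loopless := ⟨fun x hx => by
    rcases hx with hx | ⟨i, j, hij, hi, hj⟩
    exacts [hx rfl, hij.ne (firstPart_injective h (hi.trans hj.symm))]⟩

variable {k N p : ℕ} {B : SimpleGraph (Fin p)} {h : p ≤ N}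

theorem exists_firstPart_of_adj {x y : Fin ((k + 1) * N)} (hxy : (multipartiteWith k B h).Adj x y)
    (hpart : partOf x = partOf y) :
    ∃ i j, B.Adj i j ∧ firstPart k h i = x ∧ firstPart k h j = y :=
  hxy.resolve_left fun hne => hne hpart

/-- A clique has at most two vertices in the first part and one in each of the other `k`. -/
theorem multipartiteWith_cliqueFree (hB : B.CliqueFree 3) :
    (multipartiteWith k B h).CliqueFree (k + 3) := by
  intro s hs
  have h₀ : #{v ∈ s | partOf v = 0} ≤ 2 := by
    by_contra! hlt
    obtain ⟨x, hx, y, hy, z, hz, hxy, hxz, hyz⟩ := Finset.two_lt_card.1 hlt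
    rw [Finset.mem_filter] at hx hy hz
    obtain ⟨i, j, hij, hi, hj⟩ := exists_firstPart_of_adj (hs.1 hx.1 hy.1 hxy) (hx.2.trans hy.2.symm)
    obtain ⟨i', l, hil, hi', hl⟩ :=
      exists_firstPart_of_adj (hs.1 hx.1 hz.1 hxz) (hx.2.trans hz.2.symm)
    obtain ⟨j', l', hjl, hj', hl'⟩ :=
      exists_firstPart_of_adj (hs.1 hy.1 hz.1 hyz) (hy.2.trans hz.2.symm)
    obtain rfl := firstPart_injective h (hi.trans hi'.symm)
    obtain rfl := firstPart_injective h (hj.trans hj'.symm)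
    obtain rfl := firstPart_injective h (hl.trans hl'.symm)
    exact hB _ (SimpleGraph.is3Clique_triple_iff.2 ⟨hij, hil, hjl⟩)
  have h₁ : #{v ∈ s | ¬ partOf v = 0} ≤ k := by
    have hinj : Set.InjOn partOf (({v ∈ s | ¬ partOf v = 0} : Finset _) : Set (Fin ((k + 1) * N))) := by
      intro x hx y hy hxy
      rw [Finset.mem_coe, Finset.mem_filter] at hx hy
      by_contra hne
      obtain ⟨i, j, -, hi, -⟩ := exists_firstPart_of_adj (hs.1 hx.1 hy.1 hne) hxy
      exact hx.2 (hi ▸ partOf_firstPart h i)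
    have hmaps : Set.MapsTo partOf
        (({v ∈ s | ¬ partOf v = 0} : Finset _) : Set (Fin ((k + 1) * N)))
        ((univ.erase (0 : Fin (k + 1)) : Finset (Fin (k + 1))) : Set (Fin (k + 1))) := by
      intro x hx
      rw [Finset.mem_coe, Finset.mem_filter] at hx
      rw [Finset.mem_coe, Finset.mem_erase]
      exact ⟨hx.2, mem_univ _⟩
    refine (Finset.card_le_card_of_injOn _ hmaps hinj).trans ?_
    simp
  have h₂ := Finset.card_filter_add_card_filter_not (s := s) (fun v => partOf v = 0)
  rw [hs.card_eq] at h₂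
  omega

/-- Restricted to the copy of `B`, a homomorphism would be a proper colouring with `m` colours. -/
theorem multipartiteWith_not_hom {m : ℕ} (hB : ∀ φ : Fin p → Fin m, ∃ x y, B.Adj x y ∧ φ x = φ y)
    (F : SimpleGraph (Fin m)) : IsEmpty (multipartiteWith k B h →g F) := by
  refine ⟨fun φ => ?_⟩
  obtain ⟨x, y, hxy, he⟩ := hB fun i => φ (firstPart k h i)
  have hadj : (multipartiteWith k B h).Adj (firstPart k h x) (firstPart k h y) :=
    Or.inr ⟨x, y, hxy, rfl, rfl⟩
  exact (φ.map_adj hadj).ne he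

/-- A nonempty independent set stays in one part. Inside that part it can have common neighbours
only in the copy of `B`, which costs at most `p` vertices. -/
theorem exists_part_of_isNIndepSet {a : ℕ} (ha : 1 ≤ a) {I : Finset (Fin ((k + 1) * N))}
    (hI : (multipartiteWith k B h).IsNIndepSet a I) : ∃ i : Fin (k + 1),
      {v | partOf v ≠ i} ⊆ commonNbhd (multipartiteWith k B h) I ∧
      commonNbhd (multipartiteWith k B h) I ⊆ {v | partOf v ≠ i} ∪ Set.range (firstPart k h) := by
  have hne : I.Nonempty := by
    rw [← Finset.card_pos, hI.card_eq]; omega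
  obtain ⟨u, hu⟩ := hne
  have hpart : ∀ v ∈ I, partOf v = partOf u := by
    intro v hv
    by_contra hvu
    exact hI.1 hv hu (fun hvu' => hvu (hvu' ▸ rfl)) (Or.inl hvu)
  refine ⟨partOf u, fun v hv w hw => Or.inl ?_, fun v hv => ?_⟩
  · rw [hpart w hw]
    exact Ne.symm hv
  · rcases hv u hu with hv | ⟨i, j, -, -, hj⟩
    · exact Or.inl (Ne.symm hv)
    · exact Or.inr ⟨j, hj⟩

theorem ncard_partOf_ne (i : Fin (k + 1)) :
    {v : Fin ((k + 1) * N) | partOf v ≠ i}.ncard = k * N := by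
  have himg : {v : Fin ((k + 1) * N) | partOf v ≠ i} =
      finProdFinEquiv '' (((univ.erase i ×ˢ univ : Finset (Fin (k + 1) × Fin N))) :
        Set (Fin (k + 1) × Fin N)) := by
    ext v
    simp only [Set.mem_ofPred_eq, Set.mem_image, Finset.mem_coe, Finset.mem_product,
      Finset.mem_erase, mem_univ, and_true]
    constructor
    · intro hv
      exact ⟨finProdFinEquiv.symm v, hv, Equiv.apply_symm_apply _ _⟩
    · rintro ⟨x, hx, rfl⟩
      rwa [partOf_finProdFinEquiv]
  rw [himg, Set.ncard_image_of_injective _ finProdFinEquiv.injective, Set.ncard_coe_finset,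
    Finset.card_product]
  simp

theorem mul_le_ncard_commonNbhd {a : ℕ} (ha : 1 ≤ a) {I : Finset (Fin ((k + 1) * N))}
    (hI : (multipartiteWith k B h).IsNIndepSet a I) :
    k * N ≤ (commonNbhd (multipartiteWith k B h) I).ncard := by
  obtain ⟨i, hi, -⟩ := exists_part_of_isNIndepSet ha hI
  rw [← ncard_partOf_ne (N := N) i]
  exact Set.ncard_le_ncard hi (Set.toFinite _)

theorem ncard_commonNbhd_le {a : ℕ} (ha : 1 ≤ a) {I : Finset (Fin ((k + 1) * N))}
    (hI : (multipartiteWith k B h).IsNIndepSet a I) :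
    (commonNbhd (multipartiteWith k B h) I).ncard ≤ k * N + p := by
  obtain ⟨i, -, hi⟩ := exists_part_of_isNIndepSet ha hI
  refine (Set.ncard_le_ncard hi (Set.toFinite _)).trans ((Set.ncard_union_le _ _).trans ?_)
  rw [ncard_partOf_ne, ← Set.image_univ,
    Set.ncard_image_of_injective _ (firstPart_injective h), Set.ncard_univ]
  simp

theorem le_factorial_mul_numCliques_commonNbhd {a : ℕ} (ha : 1 ≤ a)
    {I : Finset (Fin ((k + 1) * N))} (hI : (multipartiteWith k B h).IsNIndepSet a I) (b : ℕ) :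
    k.descFactorial b * N ^ b ≤ b.factorial *
      numCliques b ((multipartiteWith k B h).induce (commonNbhd (multipartiteWith k B h) I)) := by
  obtain ⟨i, hi, -⟩ := exists_part_of_isNIndepSet ha hI
  rw [← card_cliqueTuples]
  have hκ : Fintype.card {j : Fin (k + 1) // j ≠ i} = k := by simp
  have hmem : ∀ x : {j : Fin (k + 1) // j ≠ i} × Fin N,
      finProdFinEquiv (x.1.1, x.2) ∈ commonNbhd (multipartiteWith k B h) I := by
    intro x
    refine hi ?_
    rw [Set.mem_ofPred_eq, partOf_finProdFinEquiv]
    exact x.1.2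
  have := descFactorial_mul_pow_le_card_cliqueTuples
    (G := (multipartiteWith k B h).induce (commonNbhd (multipartiteWith k B h) I))
    (κ := {j : Fin (k + 1) // j ≠ i}) (N := N) (fun x => ⟨finProdFinEquiv (x.1.1, x.2), hmem x⟩) ?_ ?_ b
  · rwa [hκ] at this
  · rintro ⟨j, x⟩ ⟨j', x'⟩ hx
    have := finProdFinEquiv.injective (congrArg Subtype.val hx)
    rw [Prod.mk.injEq] at this
    exact Prod.ext (Subtype.ext this.1) this.2
  · intro j j' x y hjj'
    refine Or.inl ?_
    change partOf (finProdFinEquiv (j.1, x)) ≠ partOf (finProdFinEquiv (j'.1, y))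
    rw [partOf_finProdFinEquiv, partOf_finProdFinEquiv]
    exact fun hj => hjj' (Subtype.ext hj)

end Multipartite

end HomThr

namespace HomThr

/-! ### Translation of the definitions -/

section Thresholds

open scoped Classical
open Finset

theorem completeGraph_free_iff {V : Type} {G : SimpleGraph V} {r : ℕ} :
    (SimpleGraph.completeGraph (Fin r)).Free G ↔ G.CliqueFree r := by
  have := SimpleGraph.cliqueFree_iff_top_free (G := G) (β := Fin r)
  rw [Fintype.card_fin] at this
  exact this.symm

theorem le_minCodegree_iff {V : Type} {G : SimpleGraph V} {a : ℕ} {x : ℝ} :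
    (x : EReal) ≤ minCodegree a G ↔
      ∀ I, G.IsNIndepSet a I → x ≤ ((commonNbhd G I).ncard : ℝ) := by
  simp [minCodegree, le_iInf_iff, -EReal.coe_natCast]

theorem le_minRelCliqueDensity_iff {V : Type} {G : SimpleGraph V} {a b : ℕ} {x : ℝ} :
    (x : EReal) ≤ minRelCliqueDensity a b G ↔
      ∀ I, G.IsNIndepSet a I → x ≤ relCliqueDensity b G I := by
  simp [minRelCliqueDensity, le_iInf_iff]

/-! ### Generalized Turán densities -/

/-- The generalized Turán density of `K_{b+1}` in `K_{k+1}`-free graphs. -/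
noncomputable def turanProduct (k b : ℕ) : ℝ := ∏ i ∈ range b, (1 - ((i : ℝ) + 1) / k)

theorem turanProduct_nonneg {k b : ℕ} (hk : 1 ≤ k) (hb : b ≤ k) : 0 ≤ turanProduct k b := by
  have hk' : (0 : ℝ) < k := by exact_mod_cast hk
  refine Finset.prod_nonneg fun i hi => ?_
  rw [sub_nonneg, div_le_one hk']
  have : i + 1 ≤ k := by have := Finset.mem_range.1 hi; omega
  exact_mod_cast this

/-- Links the count in balanced `k`-partite graphs to the Moon–Moser product. -/
theorem descFactorial_div_pow_eq {k b : ℕ} (hk : 1 ≤ k) (hb : b ≤ k) :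
    (k.descFactorial (b + 1) : ℝ) / (k : ℝ) ^ (b + 1) = turanProduct k b := by
  have hk' : (k : ℝ) ≠ 0 := by exact_mod_cast (by omega : k ≠ 0)
  have h₁ : (k.descFactorial (b + 1) : ℝ) = ∏ i ∈ range (b + 1), ((k : ℝ) - i) := by
    rw [Nat.descFactorial_eq_prod_range, Nat.cast_prod]
    refine Finset.prod_congr rfl fun i hi => ?_
    have := Finset.mem_range.1 hi
    rw [Nat.cast_sub (by omega)]
  have h₂ : (k : ℝ) ^ (b + 1) = ∏ _i ∈ range (b + 1), (k : ℝ) := by simp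
  rw [h₁, h₂, ← Finset.prod_div_distrib, Finset.prod_range_succ', turanProduct]
  simp only [Nat.cast_zero, sub_zero, div_self hk', mul_one]
  refine Finset.prod_congr rfl fun i _ => ?_
  push_cast
  rw [sub_div, div_self hk']

theorem tendsto_descFactorial_div_pow (b : ℕ) :
    Tendsto (fun n : ℕ => (n.descFactorial b : ℝ) / (n : ℝ) ^ b) atTop (𝓝 1) := by
  refine (Asymptotics.isEquivalent_iff_tendsto_one ?_).1 (isEquivalent_descFactorial b)
  filter_upwards [eventually_gt_atTop 0] with n hn
  positivity

theorem tendsto_nat_div_div {k : ℕ} :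
    Tendsto (fun n : ℕ => ((n / k : ℕ) : ℝ) / (n : ℝ)) atTop (𝓝 (1 / k)) := by
  have h := (tendsto_nat_floor_mul_div_atTop (R := ℝ) (a := 1 / k) (by positivity)).comp
    tendsto_natCast_atTop_atTop
  refine h.congr fun n => ?_
  simp only [Function.comp_apply]
  rw [one_div_mul_eq_div, Nat.floor_div_eq_div]

theorem numCliques_fin_le_choose {n : ℕ} (s : ℕ) (G : SimpleGraph (Fin n)) :
    numCliques s G ≤ n.choose s := by
  rw [numCliques, ← SimpleGraph.coe_cliqueFinset, Set.ncard_coe_finset]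
  simpa using SimpleGraph.card_cliqueFinset_le (G := G) (n := s)

theorem bddAbove_numCliques (n s t : ℕ) : BddAbove {k | ∃ G : SimpleGraph (Fin n),
    (SimpleGraph.completeGraph (Fin t)).Free G ∧ k = numCliques s G} := by
  refine ⟨n.choose s, ?_⟩
  rintro _ ⟨G, -, rfl⟩
  exact numCliques_fin_le_choose s G

theorem exClique_le {b k n : ℕ} (hk : 1 ≤ k) (hb : b ≤ k) (hn : 1 ≤ n) :
    ((b + 1).factorial : ℝ) * exClique n (b + 1) (k + 1) ≤
      turanProduct k b * (n : ℝ) ^ (b + 1) := by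
  have hne : {j | ∃ G : SimpleGraph (Fin n), (SimpleGraph.completeGraph (Fin (k + 1))).Free G ∧
      j = numCliques (b + 1) G}.Nonempty :=
    ⟨_, ⊥, completeGraph_free_iff.2 (SimpleGraph.cliqueFree_bot (by omega)), rfl⟩
  obtain ⟨G, hG, hmax⟩ := Nat.sSup_mem hne (bddAbove_numCliques n (b + 1) (k + 1))
  have : Nonempty (Fin n) := ⟨⟨0, hn⟩⟩
  have hd : cliqueDensity G (b + 1) ≤ turanProduct k b :=
    cliqueDensity_le_of_cliqueFree hk hb (completeGraph_free_iff.1 hG)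
  have hn' : (0 : ℝ) < (n : ℝ) ^ (b + 1) := by
    have : (0 : ℝ) < n := by exact_mod_cast hn
    positivity
  rw [cliqueDensity, card_cliqueTuples, Fintype.card_fin, div_le_iff₀ hn'] at hd
  rw [exClique, hmax]
  exact_mod_cast hd

/-- The Turán graph joins distinct residues mod `k`; the vertices `i + k x` with `x < n / k` give
`k` parts of equal size. -/
theorem le_exClique {b k n : ℕ} (hk : 1 ≤ k) :
    k.descFactorial (b + 1) * (n / k) ^ (b + 1) ≤
      (b + 1).factorial * exClique n (b + 1) (k + 1) := by
  have hle : numCliques (b + 1) (SimpleGraph.turanGraph n k) ≤ exClique n (b + 1) (k + 1) :=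
    le_csSup (bddAbove_numCliques n (b + 1) (k + 1))
      ⟨_, completeGraph_free_iff.2 (SimpleGraph.turanGraph_cliqueFree (by omega)), rfl⟩
  refine le_trans ?_ (Nat.mul_le_mul_left _ hle)
  rw [← card_cliqueTuples]
  have hlt : ∀ x : Fin k × Fin (n / k), x.1.1 + k * x.2.1 < n := by
    intro x
    calc x.1.1 + k * x.2.1 < k + k * x.2.1 := Nat.add_lt_add_right x.1.2 _
      _ = k * (x.2.1 + 1) := by ring
      _ ≤ k * (n / k) := Nat.mul_le_mul_left _ x.2.2
      _ ≤ n := Nat.mul_div_le n k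
  have hmod : ∀ x : Fin k × Fin (n / k), (x.1.1 + k * x.2.1) % k = x.1.1 := by
    intro x
    rw [Nat.add_mul_mod_self_left, Nat.mod_eq_of_lt x.1.2]
  have := descFactorial_mul_pow_le_card_cliqueTuples (G := SimpleGraph.turanGraph n k)
    (κ := Fin k) (N := n / k) (fun x => ⟨x.1.1 + k * x.2.1, hlt x⟩) ?_ ?_ (b + 1)
  · simpa using this
  · intro x y hxy
    have hxy' : x.1.1 + k * x.2.1 = y.1.1 + k * y.2.1 := congrArg Fin.val hxy
    have h₁ : x.1.1 = y.1.1 := by rw [← hmod x, hxy', hmod y]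
    have h₂ : x.2.1 = y.2.1 := by
      rw [h₁] at hxy'
      exact Nat.eq_of_mul_eq_mul_left hk (Nat.add_left_cancel hxy')
    exact Prod.ext (Fin.ext h₁) (Fin.ext h₂)
  · intro i j x y hij
    rw [SimpleGraph.turanGraph_adj]
    change (i.1 + k * x.1) % k ≠ (j.1 + k * y.1) % k
    rw [hmod (i, x), hmod (j, y)]
    exact fun h => hij (Fin.ext h)

/-- The limit defining the generalized Turán density. -/
theorem tendsto_exCliqueRatio {b k : ℕ} (hk : 1 ≤ k) (hb : b ≤ k) :
    Tendsto (exCliqueRatio (b + 1) (k + 1)) atTop (𝓝 (turanProduct k b)) := by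
  have hk' : (k : ℝ) ≠ 0 := by exact_mod_cast (by omega : k ≠ 0)
  have hlow : Tendsto (fun n : ℕ => (k.descFactorial (b + 1) : ℝ) *
      (((n / k : ℕ) : ℝ) / n) ^ (b + 1)) atTop (𝓝 (turanProduct k b)) := by
    have := (tendsto_nat_div_div (k := k)).pow (b + 1) |>.const_mul
      (k.descFactorial (b + 1) : ℝ)
    rwa [one_div, inv_pow, ← div_eq_mul_inv, descFactorial_div_pow_eq hk hb] at this
  have hupp : Tendsto (fun n : ℕ => turanProduct k b *
      ((n.descFactorial (b + 1) : ℝ) / (n : ℝ) ^ (b + 1))⁻¹) atTop (𝓝 (turanProduct k b)) := by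
    have := ((tendsto_descFactorial_div_pow (b + 1)).inv₀ one_ne_zero).const_mul (turanProduct k b)
    simpa using this
  have hratio : ∀ n : ℕ, exCliqueRatio (b + 1) (k + 1) n =
      ((b + 1).factorial * exClique n (b + 1) (k + 1) : ℝ) / (n.descFactorial (b + 1) : ℝ) := by
    intro n
    have hf : ((b + 1).factorial : ℝ) ≠ 0 := by exact_mod_cast Nat.factorial_ne_zero _
    rw [Nat.descFactorial_eq_factorial_mul_choose, Nat.cast_mul, exCliqueRatio,
      mul_div_mul_left _ _ hf]
  refine tendsto_of_tendsto_of_tendsto_of_le_of_le' hlow hupp ?_ ?_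
  · filter_upwards [eventually_ge_atTop (b + 1)] with n hn
    have hd : (0 : ℝ) < n.descFactorial (b + 1) := by
      exact_mod_cast Nat.descFactorial_pos.2 hn
    have hdn : (n.descFactorial (b + 1) : ℝ) ≤ (n : ℝ) ^ (b + 1) := by
      exact_mod_cast Nat.descFactorial_le_pow n (b + 1)
    have hle : (k.descFactorial (b + 1) : ℝ) * ((n / k : ℕ) : ℝ) ^ (b + 1) ≤
        (b + 1).factorial * exClique n (b + 1) (k + 1) := by
      exact_mod_cast le_exClique hk
    rw [hratio, div_pow, ← mul_div_assoc]
    gcongr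
  · filter_upwards [eventually_ge_atTop (b + 1)] with n hn
    have hle := exClique_le hk hb (n := n) (by omega)
    rw [hratio, inv_div, ← mul_div_assoc]
    gcongr

theorem turanCliqueDensity_eq {b k : ℕ} (hk : 1 ≤ k) (hb : b ≤ k) :
    turanCliqueDensity (b + 1) (k + 1) = turanProduct k b :=
  (tendsto_exCliqueRatio hk hb).limUnder_eq

/-! ### Lower bounds on the thresholds -/

theorem le_of_admissible {a k : ℕ} (ha : 1 ≤ a) {α : ℝ}
    (hα : Admissible a (SimpleGraph.completeGraph (Fin (k + 3))) α) :
    (k : ℝ) / (k + 1) ≤ α := by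
  by_contra! hlt
  obtain ⟨-, m, F, -, hF⟩ := hα
  obtain ⟨p, B, hB, hcol⟩ := exists_triangleFree_not_colorable m
  refine not_nonempty_iff.2 (multipartiteWith_not_hom (k := k) (h := le_refl p) hcol F)
    (hF _ _ (completeGraph_free_iff.2 (multipartiteWith_cliqueFree hB)) ?_)
  rw [le_minCodegree_iff]
  intro I hI
  have h₁ : ((k * p : ℕ) : ℝ) ≤ ((commonNbhd (multipartiteWith k B (le_refl p)) I).ncard : ℝ) := by
    exact_mod_cast mul_le_ncard_commonNbhd ha hI
  refine le_trans ?_ h₁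
  rw [lt_div_iff₀ (by positivity)] at hlt
  push_cast
  calc α * ((k + 1) * p) = (α * (k + 1)) * p := by ring
    _ ≤ k * p := by gcongr

theorem le_of_densityAdmissible {a b k : ℕ} (ha : 1 ≤ a) (hk : 1 ≤ k) (hb : b ≤ k) {α : ℝ}
    (hα : DensityAdmissible a (b + 1) (SimpleGraph.completeGraph (Fin (k + 3))) α) :
    turanProduct k b ≤ α := by
  by_contra! hlt
  have hk' : (0 : ℝ) < k := by exact_mod_cast hk
  obtain ⟨-, hα⟩ := hα
  -- The construction has co-degree at least `k N` on `(k + 1) N` vertices, so this `c` suffices.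
  -- Here `p` is fixed by `F` while `N` grows, making the `p` extra common neighbours negligible.
  obtain ⟨m, F, -, hF⟩ := hα (k / (k + 1)) (by positivity)
  obtain ⟨p, B, hB, hcol⟩ := exists_triangleFree_not_colorable m
  have hlim : Tendsto (fun N : ℕ => (k.descFactorial (b + 1) : ℝ) *
      ((N : ℝ) / (k * N + p)) ^ (b + 1)) atTop (𝓝 (turanProduct k b)) := by
    have h₁ : Tendsto (fun N : ℕ => (N : ℝ) / (k * N + p)) atTop (𝓝 (1 / k)) := by
      have h₂ : Tendsto (fun N : ℕ => (1 : ℝ) / (k + p / (N : ℝ))) atTop (𝓝 (1 / (k + 0))) :=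
        (tendsto_const_nhds).div (tendsto_const_nhds.add
          (tendsto_const_div_atTop_nhds_zero_nat (p : ℝ))) (by simpa using hk'.ne')
      rw [add_zero] at h₂
      refine h₂.congr' ?_
      filter_upwards [eventually_gt_atTop 0] with N hN
      have : (0 : ℝ) < N := by exact_mod_cast hN
      field_simp
    have := (h₁.pow (b + 1)).const_mul (k.descFactorial (b + 1) : ℝ)
    rwa [one_div, inv_pow, ← div_eq_mul_inv, descFactorial_div_pow_eq hk hb] at this
  obtain ⟨N, hN, hNp, hNb⟩ := ((hlim.eventually_const_lt hlt).and
    ((eventually_ge_atTop p).and (eventually_ge_atTop (b + 1)))).exists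
  refine not_nonempty_iff.2 (multipartiteWith_not_hom (k := k) (h := hNp) hcol F)
    (hF _ _ (completeGraph_free_iff.2 (multipartiteWith_cliqueFree hB)) ?_ ?_)
  · rw [le_minCodegree_iff]
    intro I hI
    have h₁ : ((k * N : ℕ) : ℝ) ≤ ((commonNbhd (multipartiteWith k B hNp) I).ncard : ℝ) := by
      exact_mod_cast mul_le_ncard_commonNbhd ha hI
    refine le_trans (le_of_eq ?_) h₁
    push_cast
    field_simp
  · rw [le_minRelCliqueDensity_iff]
    intro I hI
    have h₁ := mul_le_ncard_commonNbhd ha hI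
    have h₂ := ncard_commonNbhd_le ha hI
    have h₃ := le_factorial_mul_numCliques_commonNbhd ha hI (b + 1)
    set s := (commonNbhd (multipartiteWith k B hNp) I).ncard with hs
    set q := numCliques (b + 1)
      ((multipartiteWith k B hNp).induce (commonNbhd (multipartiteWith k B hNp) I)) with hq
    have hsb : b + 1 ≤ s := by nlinarith
    have hd : (0 : ℝ) < s.descFactorial (b + 1) := by
      exact_mod_cast Nat.descFactorial_pos.2 hsb
    have hdle : (s.descFactorial (b + 1) : ℝ) ≤ (k * N + p : ℝ) ^ (b + 1) := by
      have := (Nat.descFactorial_le_pow s (b + 1)).trans (Nat.pow_le_pow_left h₂ (b + 1))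
      exact_mod_cast this
    have hq' : (k.descFactorial (b + 1) : ℝ) * (N : ℝ) ^ (b + 1) ≤ (b + 1).factorial * q := by
      exact_mod_cast h₃
    have hf : ((b + 1).factorial : ℝ) ≠ 0 := by exact_mod_cast Nat.factorial_ne_zero _
    have heq : relCliqueDensity (b + 1) (multipartiteWith k B hNp) I =
        ((b + 1).factorial * q : ℝ) / (s.descFactorial (b + 1) : ℝ) := by
      rw [Nat.descFactorial_eq_factorial_mul_choose, Nat.cast_mul, mul_div_mul_left _ _ hf,
        relCliqueDensity]
    rw [heq]
    refine hN.le.trans ?_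
    rw [div_pow, ← mul_div_assoc]
    gcongr

/-! ### Upper bounds on the thresholds -/

/-- A single clique-free target for all small clique-free graphs. -/
theorem exists_universal_target (r M : ℕ) (hr : 2 ≤ r) :
    ∃ (m : ℕ) (F : SimpleGraph (Fin m)), F.CliqueFree r ∧
      ∀ m' ≤ M, ∀ F' : SimpleGraph (Fin m'), F'.CliqueFree r → Nonempty (F' →g F) := by
  let ι := {F : SimpleGraph (Fin M) // F.CliqueFree r}
  -- The disjoint union of all `K_r`-free graphs on `Fin M`; a clique stays in one component.
  -- Smaller graphs are padded with isolated vertices.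
  let S : SimpleGraph (ι × Fin M) :=
    { Adj := fun x y => x.1 = y.1 ∧ x.1.1.Adj x.2 y.2
      symm := ⟨fun x y ⟨h₁, h₂⟩ => ⟨h₁.symm, h₁ ▸ h₂.symm⟩⟩
      loopless := ⟨fun x h => h.2.ne rfl⟩ }
  have hS : S.CliqueFree r := by
    rw [cliqueFree_iff_cliqueTuples]
    refine Finset.eq_empty_of_forall_notMem fun q hq => ?_
    rw [mem_cliqueTuples] at hq
    let i₀ : Fin r := ⟨0, by omega⟩
    have h₁ : ∀ i, (q i).1 = (q i₀).1 := by
      intro i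
      by_cases hi : i = i₀
      · rw [hi]
      · exact (hq i i₀ hi).1
    have h₂ : (fun i => (q i).2) ∈ cliqueTuples (q i₀).1.1 r := by
      refine mem_cliqueTuples.2 fun i j hij => ?_
      rw [← h₁ i]
      exact (hq i j hij).2
    have h₃ := (q i₀).1.2
    rw [cliqueFree_iff_cliqueTuples] at h₃
    rw [h₃] at h₂
    simp at h₂
  let e := Fintype.equivFin (ι × Fin M)
  refine ⟨_, S.comap e.symm, cliqueFree_of_hom (F := S) ⟨e.symm, fun h => h⟩ hS,
    fun m' hm' F' hF' => ?_⟩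
  rcases isEmpty_or_nonempty (Fin m') with hV | hV
  · exact ⟨⟨fun v => isEmptyElim v, fun {v} => isEmptyElim v⟩⟩
  · have hmap : (F'.map (Fin.castLEEmb hm')).CliqueFree r :=
      SimpleGraph.cliqueFree_map_iff.2 hF'
    refine ⟨⟨fun v => e (⟨_, hmap⟩, Fin.castLEEmb hm' v), fun {x y} hxy => ?_⟩⟩
    rw [SimpleGraph.comap_adj, e.symm_apply_apply, e.symm_apply_apply]
    exact ⟨rfl, SimpleGraph.map_adj_apply.2 hxy⟩

/-- Large graphs with rich common neighbourhoods, together with all small graphs, share one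
clique-free target. -/
theorem exists_target_of_rich {a : ℕ} (t : ℕ) (ha : 2 ≤ a) {c : ℝ} (hc : 0 < c) (n₀ : ℕ) :
    ∃ (m : ℕ) (F : SimpleGraph (Fin m)), F.CliqueFree (t + 2) ∧
      ∀ (n : ℕ) (G : SimpleGraph (Fin n)), G.CliqueFree (t + 2) →
        (n₀ ≤ n → RichCommonNbhds G a t c) → Nonempty (G →g F) := by
  obtain ⟨M, hM⟩ := exists_bounded_target t ha hc
  obtain ⟨m, F, hF, huniv⟩ := exists_universal_target (t + 2) (max M n₀) (by omega)
  refine ⟨m, F, hF, fun n G hG hrich => ?_⟩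
  rcases le_total n₀ n with hn | hn
  · obtain ⟨m', hm', F', hF', ⟨φ⟩⟩ := hM hG (hrich hn)
    obtain ⟨ψ⟩ := huniv m' (hm'.trans (le_max_left _ _)) F' hF'
    exact ⟨ψ.comp φ⟩
  · exact huniv n (hn.trans (le_max_right _ _)) G hG

theorem card_cliqueTuples_induce_le {V : Type} [Fintype V] (G : SimpleGraph V) (S : Set V)
    [Fintype S] (t : ℕ) :
    #(cliqueTuples (G.induce S) t) ≤ #{q ∈ cliqueTuples G t | ∀ i, q i ∈ S} := by
  refine Finset.card_le_card_of_injOn (fun q i => (q i).1) ?_ ?_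
  · intro q hq
    rw [Finset.mem_coe, Finset.mem_filter, mem_cliqueTuples]
    exact ⟨fun i j hij => mem_cliqueTuples.1 hq i j hij, fun i => (q i).2⟩
  · intro q _ q' _ h
    funext i
    exact Subtype.ext (congrFun h i)

/-- Greedy embedding of cliques in graphs of large minimum degree. -/
theorem pow_le_card_cliqueTuples {W : Type} [Fintype W] (H : SimpleGraph W) {x y : ℝ} (hy : 0 ≤ y)
    (hx : 0 ≤ x) (hdeg : ∀ v, (#{w | ¬ H.Adj w v} : ℝ) ≤ y) {t : ℕ}
    (hW : x + t * y ≤ Fintype.card W + y) : x ^ t ≤ #(cliqueTuples H t) := by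
  induction t with
  | zero =>
    have : cliqueTuples H 0 = univ :=
      Finset.eq_univ_of_forall fun q => mem_cliqueTuples.2 fun i => i.elim0
    rw [this]
    simp
  | succ t ih =>
    push_cast at hW
    -- Each of the `t` entries excludes at most `y` vertices, and `hW` now reads `x ≤ |W| - t y`.
    have hnb : ∀ q : Fin t → W, x ≤ #(tupleNbhd H q) := by
      intro q
      have hsub : (tupleNbhd H q)ᶜ ⊆ (univ : Finset (Fin t)).biUnion
          fun i => {w | ¬ H.Adj w (q i)} := by
        intro w hw
        rw [Finset.mem_compl, mem_tupleNbhd] at hw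
        push Not at hw
        obtain ⟨i, hi⟩ := hw
        exact Finset.mem_biUnion.2 ⟨i, mem_univ _, by simpa using hi⟩
      have h₁ := (Finset.card_le_card hsub).trans Finset.card_biUnion_le
      have h₂ : (#(tupleNbhd H q)ᶜ : ℝ) ≤ ∑ i : Fin t, (#{w | ¬ H.Adj w (q i)} : ℝ) := by
        exact_mod_cast h₁
      have h₃ : ∑ i : Fin t, (#{w | ¬ H.Adj w (q i)} : ℝ) ≤ t * y := by
        refine (Finset.sum_le_sum fun i _ => hdeg (q i)).trans ?_
        simp
      rw [Finset.card_compl, Nat.cast_sub (Finset.card_le_univ _)] at h₂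
      linarith
    rw [card_cliqueTuples_succ, pow_succ]
    push_cast
    calc x ^ t * x ≤ #(cliqueTuples H t) * x := by
          gcongr
          exact ih (by linarith)
      _ = ∑ _q ∈ cliqueTuples H t, x := by simp
      _ ≤ _ := Finset.sum_le_sum fun q _ => hnb q

/-- Every value above `k/(k+1)` is admissible. -/
theorem admissible_of_lt {a k : ℕ} (ha : 2 ≤ a) {α : ℝ} (hα : (k : ℝ) / (k + 1) < α) :
    Admissible a (SimpleGraph.completeGraph (Fin (k + 3))) α := by
  have hα0 : 0 ≤ α := le_trans (by positivity) hα.le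
  have hlt1 : (k : ℝ) / (k + 1) < 1 := by
    rw [div_lt_one (by positivity)]; linarith
  -- As `α` may be at least `1`, it is replaced by some `β < 1`, so that `1 - β` is positive.
  obtain ⟨β, hβ₁, hβ₂⟩ := exists_between (lt_min hα hlt1)
  have hβα : β ≤ α := hβ₂.le.trans (min_le_left _ _)
  have hβ1 : β < 1 := hβ₂.trans_le (min_le_right _ _)
  -- Equals `β - k (1 - β)`: from `β n` common neighbours, `k` greedy choices each exclude at most
  -- `(1 - β) n`.
  set η : ℝ := 1 - (k + 1) * (1 - β) with hη
  have hη0 : 0 < η := by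
    rw [div_lt_iff₀ (by positivity)] at hβ₁
    linarith
  obtain ⟨D, hD⟩ := exists_card_isolatedPair_le (k + 1) ha
  obtain ⟨n₀, hn₀⟩ := exists_nat_gt (D / (1 - β))
  have hγ : 0 < 1 - β := by linarith
  obtain ⟨m, F, hF, hhom⟩ := exists_target_of_rich (k + 1) ha (pow_pos hη0 (k + 1)) n₀
  refine ⟨hα0, m, F, completeGraph_free_iff.2 hF, fun n G hG hdeg => ?_⟩
  rw [completeGraph_free_iff] at hG
  rw [le_minCodegree_iff] at hdeg
  refine hhom n G hG fun hn => ?_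
  -- A vertex in an independent `a`-set inherits its degree from the co-degree. Any other vertex
  -- forms isolated pairs with all its non-neighbours, at most `D` of them, and `n₀` makes `D` small
  -- enough.
  have hnonadj : ∀ v, (#{w | ¬ G.Adj w v} : ℝ) ≤ (1 - β) * n := by
    intro v
    by_cases hv : ∃ I, G.IsNIndepSet a I ∧ v ∈ I
    · obtain ⟨I, hI, hvI⟩ := hv
      have h₁ := hdeg I hI
      have hsub : commonNbhd G I ⊆ (({w | G.Adj w v} : Finset (Fin n)) : Set (Fin n)) := by
        intro w hw
        simpa using (hw v hvI).symm
      have h₂ := Set.ncard_le_ncard hsub (Finset.finite_toSet _)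
      rw [Set.ncard_coe_finset] at h₂
      have h₃ := Finset.card_filter_add_card_filter_not (s := (univ : Finset (Fin n)))
        (fun w => G.Adj w v)
      rw [Finset.card_univ, Fintype.card_fin] at h₃
      have h₂' : ((commonNbhd G I).ncard : ℝ) ≤ #{w | G.Adj w v} := by exact_mod_cast h₂
      have h₃' : (#{w | G.Adj w v} : ℝ) + #{w | ¬ G.Adj w v} = n := by exact_mod_cast h₃
      have h₄ : β * n ≤ α * n := by gcongr
      linarith
    · have hsub : ({w | ¬ G.Adj w v} : Finset (Fin n)) ⊆
          ({w | IsolatedPair G a v w} : Finset (Fin n)) := by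
        intro w hw
        rw [Finset.mem_filter] at hw ⊢
        refine ⟨mem_univ _, Or.inr ⟨fun h => hw.2 h.symm, ?_⟩⟩
        rintro ⟨I, hI, hvI, -⟩
        exact hv ⟨I, hI, hvI⟩
      have h₁ : (#{w | ¬ G.Adj w v} : ℝ) ≤ D := by
        exact_mod_cast (Finset.card_le_card hsub).trans (hD hG v)
      have hn' : (n₀ : ℝ) ≤ n := by exact_mod_cast hn
      rw [div_lt_iff₀ hγ] at hn₀
      nlinarith
  intro I hI
  have hcard := card_cliqueTuples_induce_le G (commonNbhd G I) (k + 1)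
  have hcard' : (#(cliqueTuples (G.induce (commonNbhd G I)) (k + 1)) : ℝ) ≤
    #{q ∈ cliqueTuples G (k + 1) | ∀ i, q i ∈ commonNbhd G I} := by exact_mod_cast hcard
  refine le_trans ?_ hcard'
  rw [Fintype.card_fin, ← mul_pow]
  refine pow_le_card_cliqueTuples (G.induce (commonNbhd G I)) (y := (1 - β) * n) (by positivity)
    (by positivity) ?_ ?_
  · intro v
    refine le_trans ?_ (hnonadj v.1)
    have : #{w | ¬ (G.induce (commonNbhd G I)).Adj w v} ≤ #{w | ¬ G.Adj w v.1} := by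
      refine Finset.card_le_card_of_injOn Subtype.val ?_ Subtype.val_injective.injOn
      intro w hw
      simpa using hw
    exact_mod_cast this
  · have h₁ := hdeg I hI
    rw [← Nat.card_eq_fintype_card, Nat.card_coe_set_eq]
    have h₄ : β * n ≤ α * n := by gcongr
    rw [hη]
    push_cast
    nlinarith

/-- Every value above the generalized Turán density is admissible. -/
theorem densityAdmissible_of_lt {a b k : ℕ} (ha : 2 ≤ a) (hk : 1 ≤ k) (hb : b ≤ k) {α : ℝ}
    (hα : turanProduct k b < α) :
    DensityAdmissible a (b + 1) (SimpleGraph.completeGraph (Fin (k + 3))) α := by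
  have hα0 : 0 < α := (turanProduct_nonneg hk hb).trans_lt hα
  refine ⟨hα0.le, fun c hc => ?_⟩
  -- The gap between `α'` and `α` absorbs the passage from `s.choose (b + 1)` to the normalisation
  -- by `s ^ (b + 1)`, valid for `s ≥ m₀`.
  obtain ⟨α', hα'₁, hα'₂⟩ := exists_between hα
  obtain ⟨c₁, hc₁, hsup⟩ := supersaturation hk hb hα'₁
  have hlim := (tendsto_descFactorial_div_pow (b + 1)).const_mul α
  rw [mul_one] at hlim
  obtain ⟨m₀, hm₀⟩ := eventually_atTop.1 (hlim.eventually_const_lt hα'₂)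
  obtain ⟨n₀, hn₀⟩ := exists_nat_gt (((m₀ : ℝ) + 1) / c)
  rw [div_lt_iff₀ hc] at hn₀
  obtain ⟨m, F, hF, hhom⟩ := exists_target_of_rich (k + 1) ha
    -- Supersaturation gives `c₁ s^{k+1}` ordered cliques in a common neighbourhood of size `s ≥ c
    -- n`.
    (mul_pos hc₁ (pow_pos hc (k + 1))) n₀
  refine ⟨m, F, completeGraph_free_iff.2 hF, fun n G hG hdeg hdens => ?_⟩
  rw [completeGraph_free_iff] at hG
  rw [le_minCodegree_iff] at hdeg
  rw [le_minRelCliqueDensity_iff] at hdens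
  refine hhom n G hG fun hn I hI => ?_
  have hcard := card_cliqueTuples_induce_le G (commonNbhd G I) (k + 1)
  have hcard' : (#(cliqueTuples (G.induce (commonNbhd G I)) (k + 1)) : ℝ) ≤
    #{q ∈ cliqueTuples G (k + 1) | ∀ i, q i ∈ commonNbhd G I} := by exact_mod_cast hcard
  refine le_trans ?_ hcard'
  have h₁ := hdeg I hI
  have h₂ := hdens I hI
  rw [relCliqueDensity] at h₂
  set s := (commonNbhd G I).ncard with hs
  have hsW : Fintype.card (commonNbhd G I) = s := by
    rw [← Nat.card_eq_fintype_card, Nat.card_coe_set_eq]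
  have hsm : (m₀ : ℝ) + 1 < s := by
    have hn' : (n₀ : ℝ) ≤ n := by exact_mod_cast hn
    nlinarith
  have hsm' : m₀ + 1 < s := by exact_mod_cast hsm
  have hs0 : (0 : ℝ) < s := by exact_mod_cast (by omega : 0 < s)
  have hne : Nonempty (commonNbhd G I) := by
    rw [← Fintype.card_pos_iff, hsW]; omega
  have h₃ : α * (s.choose (b + 1) : ℝ) ≤
      numCliques (b + 1) (G.induce (commonNbhd G I)) := by
    refine mul_le_of_le_div₀ (by positivity) (by positivity) h₂
  have hdensity : α' ≤ cliqueDensity (G.induce (commonNbhd G I)) (b + 1) := by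
    refine (hm₀ s (by omega)).le.trans ?_
    rw [cliqueDensity, hsW, card_cliqueTuples, ← mul_div_assoc,
      Nat.descFactorial_eq_factorial_mul_choose]
    push_cast
    gcongr ?_ / _
    calc α * (((b + 1).factorial : ℝ) * (s.choose (b + 1) : ℝ))
        = ((b + 1).factorial : ℝ) * (α * (s.choose (b + 1) : ℝ)) := by ring
      _ ≤ _ := by gcongr
  have h₄ := hsup _ hdensity
  rw [cliqueDensity, hsW, le_div_iff₀ (by positivity)] at h₄
  refine le_trans ?_ h₄
  rw [Fintype.card_fin, mul_assoc, ← mul_pow]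
  gcongr

theorem homThreshold_eq {a k : ℕ} (ha : 2 ≤ a) :
    homThreshold a (SimpleGraph.completeGraph (Fin (k + 3))) =
      (((k : ℝ) / (k + 1) : ℝ) : EReal) := by
  refine le_antisymm ?_ (le_iInf₂ fun α hα => ?_)
  · rw [← EReal.le_of_forall_lt_iff_le]
    intro α hα
    exact iInf₂_le α (admissible_of_lt ha (EReal.coe_lt_coe_iff.1 hα))
  · exact EReal.coe_le_coe_iff.2 (le_of_admissible (by omega) hα)

theorem homDensityThreshold_eq {a b k : ℕ} (ha : 2 ≤ a) (hk : 1 ≤ k) (hb : b ≤ k) :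
    homDensityThreshold a (b + 1) (SimpleGraph.completeGraph (Fin (k + 3))) =
      ((turanProduct k b : ℝ) : EReal) := by
  refine le_antisymm ?_ (le_iInf₂ fun α hα => ?_)
  · rw [← EReal.le_of_forall_lt_iff_le]
    intro α hα
    exact iInf₂_le α (densityAdmissible_of_lt ha hk hb (EReal.coe_lt_coe_iff.1 hα))
  · exact EReal.coe_le_coe_iff.2 (le_of_densityAdmissible (by omega) hk hb hα)

end Thresholds

end HomThr

theorem mainTheorem6 (r a : ℕ) (hr : 3 ≤ r) (ha : 2 ≤ a) :
    HomThr.homThreshold a (SimpleGraph.completeGraph (Fin r)) =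
        (((((r : ℝ) - 3) / ((r : ℝ) - 2) : ℝ)) : EReal) ∧
    ∀ b : ℕ, 2 ≤ b → b + 2 ≤ r →
      HomThr.homDensityThreshold a b (SimpleGraph.completeGraph (Fin r)) =
          ((HomThr.turanCliqueDensity b (r - 2) : ℝ) : EReal) ∧
      Tendsto (HomThr.exCliqueRatio b (r - 2)) atTop
          (𝓝 (HomThr.turanCliqueDensity b (r - 2))) ∧
      HomThr.turanCliqueDensity b (r - 2) =
          ∏ i ∈ Finset.Icc 1 (b - 1), ((r : ℝ) - 3 - (i : ℝ)) / ((r : ℝ) - 3) := by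
  obtain ⟨k, rfl⟩ := Nat.exists_eq_add_of_le' hr
  refine ⟨?_, fun b hb hbr => ?_⟩
  · rw [HomThr.homThreshold_eq ha]
    congr 2 <;> push_cast <;> ring
  · obtain ⟨b, rfl⟩ := Nat.exists_eq_add_of_le' (by omega : 1 ≤ b)
    have hk : 1 ≤ k := by omega
    have hbk : b ≤ k := by omega
    have hk' : (k : ℝ) ≠ 0 := by exact_mod_cast (by omega : k ≠ 0)
    have hsub : k + 3 - 2 = k + 1 := by omega
    rw [hsub, HomThr.turanCliqueDensity_eq hk hbk]
    refine ⟨HomThr.homDensityThreshold_eq ha hk hbk, HomThr.tendsto_exCliqueRatio hk hbk, ?_⟩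
    -- Reindexes the product, since `turanProduct` counts its factors from `0`.
    have hIcc : Finset.Icc 1 b = Finset.Ico (0 + 1) (b + 1) := by
      ext i
      simp only [Finset.mem_Icc, Finset.mem_Ico]
      omega
    rw [HomThr.turanProduct, Nat.add_sub_cancel, Finset.range_eq_Ico, hIcc,
      ← Finset.prod_Ico_add']
    refine Finset.prod_congr rfl fun i _ => ?_
    push_cast
    rw [add_sub_cancel_right, sub_div, div_self hk']
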